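/- **Setting.** Let $n,m\in\mathbb N$, $0\le t\le T$. Consider the state equation $$\dot X(s)=A(s,X(s))+B(s,X(s))u(s),\quad s\in[t,T],\qquad X(t)=x\in\mathbb R^n,$$ with controls $u\in\mathcal U[t,T]=L^2(t,T;\mathbb R^m)$, and the cost $$J(t,x;u)=\int_t^T\Big[Q(s,X(s))+\langle S(s,X(s)),u(s)\rangle+\tfrac12\langle R(s,X(s))u(s),u(s)\rangle\Big]ds+G(X(T)).$$ Vectors carry the Euclidean norm and matrices the operator norm. Assume: (H1) $A:[0,T]\times\mathbb R^n\to\mathbb R^n$ and $B:[0,T]\times\mathbb R^n\to\mathbb R^{n\times m}$ are continuous, and there are $L_A,L_B,\tilde L_B>0$ with $|A(s,x)-A(s,\bar x)|\le L_A|x-\bar x|$, $|B(s,x)-B(s,\bar x)|\le\tilde L_B|x-\bar x|$ and $\langle[B(s,x)-B(s,\bar x)]^T(x-\bar x),u\rangle\le L_B|x-\bar x|^2$ for all $s\in[0,T]$, $x,\bar x\in\mathbb R^n$, $u\in\mathbb R^m$. (H2) $Q:[0,T]\times\mathbb R^n\to\mathbb R$, $S:[0,T]\times\mathbb R^n\to\mathbb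 R^m$, $R:[0,T]\times\mathbb R^n\to\mathbb S^m$ (symmetric matrices) and $G:\mathbb R^n\to\mathbb R$ are continuous, and there are constants $L,Q_0,G_0,S_0,\rho_0>0$, $\varepsilon_0\in(0,1)$ and a continuous $\rho:\mathbb R^n\to[\rho_0,\infty)$ such that on $[0,T]\times\mathbb R^n$: $R\ge\rho(x)I$; $(1-\varepsilon_0)Q-\frac12S^TR^{-1}S\ge-L$; $G\ge-L$; $Q\le Q_0(1+|x|^2)$; $G\le G_0(1+|x|^2)$; $|S|\le S_0(1+|x|)$; $|A+BR^{-1}S|\le L(1+|x|)$; $|BR^{-1}B^T|\le L$. (H3) $A,B,Q,S,R,G$ are twice continuously differentiable (in $(s,x)$ on $[0,T]\times\mathbb R^n$). **Proposition 5.4.** Let (H1)–(H3) hold with $$A(s,x)=A(s)x,\quad B(s,x)=B(s),\quad S(s,x)=S(s)x,\quad R(s,x)=R(s)\qquad(s\in[0,T],\ x\in\mathbb R^n).$$ Let $\Phi_A$ be the fundamental matrix of $A(\cdot)$, i.e. $\frac{d}{ds}\Phi_A(s,\tau)=A(s)\Phi_A(s,\tau)$ for $t\le\tau\le s\le T$,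 $\Phi_A(\tau,\tau)=I$. Let $\alpha\in(0,1)$ and $\delta>0$, let $\bar G$ be a symmetric positive semidefinite $n\times n$ matrix and $\bar Q$ a map from $[0,T]$ to the symmetric positive semidefinite $n\times n$ matrices, and put $$\widehat G(t)=\Big[\int_t^T\!\!\int_t^T|B(s)^T\Phi_A(T,s)^T\bar G\,\Phi_A(T,r)B(r)|^2\,dr\,ds\Big]^{1/2},$$ $$\widehat Q(s,t)=\int_s^T\Big[\int_t^\tau\!\!\int_t^\tau|B(r)^T\Phi_A(\tau,r)^T\bar Q(\tau)\Phi_A(\tau,r')B(r')|^2\,dr'\,dr\Big]^{1/2}d\tau,$$ where the function of $\tau$ under the outer integral in $\widehat Q$ is assumed to be integrable on $[t,T]$. Suppose that $$Q_{xx}(s,x)+\bar Q(s)-\alpha^{-1}S(s)^TR(s)^{-1}S(s)\ge0,\qquad G_{xx}(x)+\bar G\ge0,\qquad (s,x)\in[t,T]\times\mathbb R^n,$$ $$(1-\alpha)R(s)-[\widehat G(t)+\widehat Q(s,t)]I\ge\delta I,\qquad s\in[t,T].$$ Then, for every $x\in\mathbb R^n$, the state equation has exactly one solution on $[t,T]$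 for each $u\in\mathcal U[t,T]$, the functional $u\mapsto J(t,x;u)$ is twice Fréchet differentiable on $\mathcal U[t,T]$, and its Hessian $D_{uu}J(t,x;u)$ is uniformly positive definite: $$\langle D_{uu}J(t,x;u)v,v\rangle_{L^2}\ge\delta\,\|v\|_{L^2}^2\qquad\text{for all }u,v\in\mathcal U[t,T].$$ -/

import Mathlib

open MeasureTheory Set

noncomputable section

/-- `ℝᵏ` with its Euclidean norm.  An `i × j` matrix is represented by the corresponding
continuous linear map `Vec j →L[ℝ] Vec i`; its norm is the operator norm and its transpose is the
adjoint. -/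
abbrev Vec (k : ℕ) : Type := EuclideanSpace ℝ (Fin k)

/-- Admissible controls on `[t, T]`: the Hilbert space `L²(t, T; ℝᵐ)` (the control set is the whole
of `ℝᵐ`). -/
abbrev Control (m : ℕ) (t T : ℝ) : Type :=
  Lp (Vec m) 2 ((volume : Measure ℝ).restrict (Icc t T))

/-- The coefficients of an affine-quadratic optimal control problem: state equation
`X' = A(s, X) + B(s, X) u`, running cost `Q(s, X) + ⟨S(s, X), u⟩ + ½ ⟨R(s, X) u, u⟩`,
terminal cost `G(X(T))`. -/
structure AQProblem (n m : ℕ) where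
  A : ℝ → Vec n → Vec n
  B : ℝ → Vec n → (Vec m →L[ℝ] Vec n)
  Q : ℝ → Vec n → ℝ
  S : ℝ → Vec n → Vec m
  R : ℝ → Vec n → (Vec m →L[ℝ] Vec m)
  G : Vec n → ℝ

namespace AQProblem

variable {n m : ℕ}

/-- Hypothesis (H1) on `[0, T]`, with control set `ℝᵐ`. -/
def H1 (P : AQProblem n m) (T : ℝ) : Prop :=
  ContinuousOn (fun p : ℝ × Vec n => P.A p.1 p.2) (Icc 0 T ×ˢ univ) ∧
  ContinuousOn (fun p : ℝ × Vec n => P.B p.1 p.2) (Icc 0 T ×ˢ univ) ∧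
  ∃ LA LB LB' : ℝ, 0 < LA ∧ 0 < LB ∧ 0 < LB' ∧
    ∀ s ∈ Icc 0 T, ∀ x y : Vec n,
      ‖P.A s x - P.A s y‖ ≤ LA * ‖x - y‖ ∧
      ‖P.B s x - P.B s y‖ ≤ LB' * ‖x - y‖ ∧
      ∀ u : Vec m,
        inner ℝ ((P.B s x - P.B s y).adjoint (x - y)) u ≤ LB * ‖x - y‖ ^ 2

/-- Hypothesis (H2) on `[0, T]`: continuity, symmetry of `R`, uniform positivity of `R`, and the
growth and lower bounds on the coefficients. -/
def H2 (P : AQProblem n m) (T : ℝ) : Prop :=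
  ContinuousOn (fun p : ℝ × Vec n => P.Q p.1 p.2) (Icc 0 T ×ˢ univ) ∧
  ContinuousOn (fun p : ℝ × Vec n => P.S p.1 p.2) (Icc 0 T ×ˢ univ) ∧
  ContinuousOn (fun p : ℝ × Vec n => P.R p.1 p.2) (Icc 0 T ×ˢ univ) ∧
  Continuous P.G ∧
  (∀ s ∈ Icc 0 T, ∀ x : Vec n, IsSelfAdjoint (P.R s x)) ∧
  ∃ (L Q₀ G₀ S₀ ε₀ ρ₀ : ℝ) (ρ : Vec n → ℝ),
    0 < L ∧ 0 < Q₀ ∧ 0 < G₀ ∧ 0 < S₀ ∧ 0 < ε₀ ∧ ε₀ < 1 ∧ 0 < ρ₀ ∧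
    Continuous ρ ∧ (∀ x, ρ₀ ≤ ρ x) ∧
    ∀ s ∈ Icc 0 T, ∀ x : Vec n,
      (∀ w : Vec m, ρ x * ‖w‖ ^ 2 ≤ inner ℝ (P.R s x w) w) ∧
      -L ≤ (1 - ε₀) * P.Q s x - 1 / 2 * inner ℝ ((P.R s x).inverse (P.S s x)) (P.S s x) ∧
      -L ≤ P.G x ∧
      P.Q s x ≤ Q₀ * (1 + ‖x‖ ^ 2) ∧
      P.G x ≤ G₀ * (1 + ‖x‖ ^ 2) ∧
      ‖P.S s x‖ ≤ S₀ * (1 + ‖x‖) ∧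
      ‖P.A s x + P.B s x ((P.R s x).inverse (P.S s x))‖ ≤ L * (1 + ‖x‖) ∧
      ‖P.B s x ∘L (P.R s x).inverse ∘L (P.B s x).adjoint‖ ≤ L

/-- Hypothesis (H3): all coefficients are twice continuously differentiable on `[0, T] × ℝⁿ`. -/
def H3 (P : AQProblem n m) (T : ℝ) : Prop :=
  ContDiffOn ℝ 2 (fun p : ℝ × Vec n => P.A p.1 p.2) (Icc 0 T ×ˢ univ) ∧
  ContDiffOn ℝ 2 (fun p : ℝ × Vec n => P.B p.1 p.2) (Icc 0 T ×ˢ univ) ∧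
  ContDiffOn ℝ 2 (fun p : ℝ × Vec n => P.Q p.1 p.2) (Icc 0 T ×ˢ univ) ∧
  ContDiffOn ℝ 2 (fun p : ℝ × Vec n => P.S p.1 p.2) (Icc 0 T ×ˢ univ) ∧
  ContDiffOn ℝ 2 (fun p : ℝ × Vec n => P.R p.1 p.2) (Icc 0 T ×ˢ univ) ∧
  ContDiff ℝ 2 P.G

/-- `X` solves `X' = A(s, X) + B(s, X) u` on `[t, T]` with `X(t) = x`, in the (Carathéodory)
integral sense. -/
def IsTrajectory (P : AQProblem n m) (t T : ℝ) (x : Vec n) (u : Control m t T)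
    (X : ℝ → Vec n) : Prop :=
  ContinuousOn X (Icc t T) ∧
  IntervalIntegrable (fun r => P.A r (X r) + P.B r (X r) (u r)) volume t T ∧
  ∀ s ∈ Icc t T, X s = x + ∫ r in t..s, (P.A r (X r) + P.B r (X r) (u r))

open Classical in
/-- The state trajectory `X(·; t, x, u)`; only its values on `[t, T]` matter. -/
def trajectory (P : AQProblem n m) (t T : ℝ) (x : Vec n) (u : Control m t T) : ℝ → Vec n :=
  if h : ∃ X, P.IsTrajectory t T x u X then h.choose else 0

/-- The cost functional `J(t, x; u)`. -/
def cost (P : AQProblem n m) (t T : ℝ) (x : Vec n) (u : Control m t T) : ℝ :=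
  (∫ s in t..T,
    (P.Q s (P.trajectory t T x u s) + inner ℝ (P.S s (P.trajectory t T x u s)) (u s)
      + 1 / 2 * inner ℝ (P.R s (P.trajectory t T x u s) (u s)) (u s)))
    + P.G (P.trajectory t T x u T)

/-- `D_u J(t, x; u)`, as an element of `L²(t, T; ℝᵐ)` (Fréchet derivative and Riesz
representation). -/
def DuJ (P : AQProblem n m) (t T : ℝ) (x : Vec n) (u : Control m t T) : Control m t T :=
  gradient (P.cost t T x) u

/-- `D_uu J(t, x; u)`, the Fréchet derivative of `u ↦ D_u J(t, x; u)`: a bounded linear operator on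
`L²(t, T; ℝᵐ)`. -/
def DuuJ (P : AQProblem n m) (t T : ℝ) (x : Vec n) (u : Control m t T) :
    Control m t T →L[ℝ] Control m t T :=
  fderiv ℝ (P.DuJ t T x) u

end AQProblem

/-- `Φ(s, τ)`, `t ≤ τ ≤ s ≤ T`, is the fundamental matrix of `A(·)` on `[t, T]`:
`∂Φ/∂s (s, τ) = A(s) Φ(s, τ)` and `Φ(τ, τ) = I`. -/
def IsFundamentalMatrix {n : ℕ} (A : ℝ → (Vec n →L[ℝ] Vec n)) (t T : ℝ)
    (Φ : ℝ → ℝ → (Vec n →L[ℝ] Vec n)) : Prop :=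
  ∀ τ ∈ Icc t T, Φ τ τ = ContinuousLinearMap.id ℝ (Vec n) ∧
    ∀ s ∈ Icc τ T, HasDerivWithinAt (fun σ => Φ σ τ) (A s ∘L Φ s τ) (Icc τ T) s

open Classical in
/-- The fundamental matrix `Φ_A(s, τ)` of `A(·)` on `[t, T]`; only its values at
`t ≤ τ ≤ s ≤ T` matter. -/
def fundamentalMatrix {n : ℕ} (A : ℝ → (Vec n →L[ℝ] Vec n)) (t T : ℝ) :
    ℝ → ℝ → (Vec n →L[ℝ] Vec n) :=
  if h : ∃ Φ, IsFundamentalMatrix A t T Φ then h.choose else 0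

/-- `[∫_t^τ ∫_t^τ |B(r)ᵀ Φ_A(τ, r)ᵀ M Φ_A(τ, r') B(r')|² dr' dr]^{1/2}`. -/
def kernelNorm {n m : ℕ} (A : ℝ → (Vec n →L[ℝ] Vec n)) (B : ℝ → (Vec m →L[ℝ] Vec n)) (t T : ℝ)
    (M : Vec n →L[ℝ] Vec n) (τ : ℝ) : ℝ :=
  √(∫ r in t..τ, ∫ r' in t..τ,
    ‖(B r).adjoint ∘L (fundamentalMatrix A t T τ r).adjoint ∘L M ∘L
      fundamentalMatrix A t T τ r' ∘L B r'‖ ^ 2)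

/-- `Ĝ(t)`. -/
def GHat {n m : ℕ} (A : ℝ → (Vec n →L[ℝ] Vec n)) (B : ℝ → (Vec m →L[ℝ] Vec n)) (t T : ℝ)
    (Gbar : Vec n →L[ℝ] Vec n) : ℝ :=
  kernelNorm A B t T Gbar T

/-- `Q̂(s, t)`. -/
def QHat {n m : ℕ} (A : ℝ → (Vec n →L[ℝ] Vec n)) (B : ℝ → (Vec m →L[ℝ] Vec n)) (t T : ℝ)
    (Qbar : ℝ → (Vec n →L[ℝ] Vec n)) (s : ℝ) : ℝ :=
  ∫ τ in s..T, kernelNorm A B t T (Qbar τ) τ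

/-- The quadratic form `⟨f_xx(x) h, h⟩` of the Hessian of `f : ℝⁿ → ℝ`. -/
def hessianForm {n : ℕ} (f : Vec n → ℝ) (x h : Vec n) : ℝ :=
  fderiv ℝ (fderiv ℝ f) x h h

end

/-! Since the drift is linear in the state and `B` does not depend on it, the trajectory is affine
in the control: `X = X₀ + Y u`, where `X₀` is the free motion and `(Y u)(s) = ∫_t^s Φ_A(s, r) B(r)
u(r) dr`. The cost is therefore `∫ Q(s, X₀ + Y u) ds`, plus a bounded linear and a bounded quadratic
functional of `u`, plus `G(X₀(T) + Y(T) u)`. It is twice differentiable, and with `y = Y v` its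
second variation is `∫ [⟨Q_xx y, y⟩ + 2⟨S y, v⟩ + ⟨R v, v⟩] ds + ⟨G_xx y(T), y(T)⟩`.

Semiconvexity bounds the Hessians below by `-Q̄ + α⁻¹ Sᵀ R⁻¹ S` and `-Ḡ`. The term `α⁻¹ Sᵀ R⁻¹ S`
and the share `α R` absorb the cross term by completing the square
(`two_mul_inner_add_inner_nonneg`), leaving `(1 - α) R`. The negative terms are quadratic in `y`,
which is an integral operator applied to `v`, so a Hilbert–Schmidt estimate
(`IsFlowPair.inner_le_kernelNorm`) gives `⟨M y(τ), y(τ)⟩ ≤ kernelNorm(τ) ∫_t^τ |v|²`. Integrating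
over `τ` and exchanging the order (`integral_mul_primitive`) produces exactly the weight `Q̂(s, t)`
on `|v(s)|²`, and `Ḡ` produces `Ĝ(t)`; largeness of `R` closes the estimate
(`AQProblem.le_second_variation`). -/

noncomputable section

/-! ### Calculus on compact intervals. -/

section Auxiliary

variable {E F H : Type*} [NormedAddCommGroup E] [NormedSpace ℝ E]
  [NormedAddCommGroup F] [NormedSpace ℝ F] [NormedAddCommGroup H] [NormedSpace ℝ H]

theorem hasDerivWithinAt_integral_Icc [CompleteSpace E] {f : ℝ → E} {a b : ℝ}
    (hab : a ≤ b) (hf : ContinuousOn f (Icc a b)) {s : ℝ} (hs : s ∈ Icc a b) :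
    HasDerivWithinAt (fun σ => ∫ r in a..σ, f r) (f s) (Icc a b) s := by
  -- The integrand is extended by constants beyond `[a, b]`, so that the two-sided fundamental
  -- theorem of calculus also serves the endpoints.
  have hc : Continuous (IccExtend hab ((Icc a b).domRestrict f)) :=
    (continuousOn_iff_continuous_domRestrict.1 hf).Icc_extend'
  have h := (intervalIntegral.integral_hasDerivAt_right (hc.intervalIntegrable a s)
    (hc.stronglyMeasurableAtFilter _ _) hc.continuousAt).hasDerivWithinAt (s := Icc a b)
  rw [IccExtend_of_mem hab _ hs] at h
  refine h.congr (fun σ hσ => ?_) ?_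
  all_goals
    refine intervalIntegral.integral_congr fun r hr => ?_
    rw [uIcc_of_le (by first | exact hσ.1 | exact hs.1)] at hr
    rw [IccExtend_of_mem hab _ ⟨hr.1, hr.2.trans (by first | exact hσ.2 | exact hs.2)⟩]
    rfl

theorem eq_left_of_hasDerivWithinAt_zero {f : ℝ → E} {a b : ℝ}
    (hf : ∀ s ∈ Icc a b, HasDerivWithinAt f 0 (Icc a b) s) {s : ℝ} (hs : s ∈ Icc a b) :
    f s = f a :=
  constant_of_has_deriv_right_zero (fun r hr => (hf r hr).continuousWithinAt)
    (fun r hr => (hf r ⟨hr.1, hr.2.le⟩).mono_of_mem_nhdsWithin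
      (Icc_mem_nhdsGE_of_mem hr)) s hs

theorem integral_eq_sub_of_hasDerivWithinAt_Icc [CompleteSpace E] {f f' : ℝ → E} {a b : ℝ}
    (hf : ∀ s ∈ Icc a b, HasDerivWithinAt f (f' s) (Icc a b) s)
    (hf' : ContinuousOn f' (Icc a b)) {r s : ℝ} (hr : r ∈ Icc a b) (hs : s ∈ Icc a b) :
    ∫ σ in r..s, f' σ = f s - f r := by
  have hab : a ≤ b := hr.1.trans hr.2
  have key : ∀ s ∈ Icc a b, ∫ σ in a..s, f' σ = f s - f a := by
    intro s hs
    have := eq_left_of_hasDerivWithinAt_zero (f := fun s => (∫ σ in a..s, f' σ) - f s)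
      (a := a) (b := b) (fun r hr => by
        have h := (hasDerivWithinAt_integral_Icc hab hf' hr).sub (hf r hr)
        rw [sub_self] at h
        exact h) hs
    simp only [intervalIntegral.integral_same, zero_sub] at this
    rw [sub_eq_iff_eq_add] at this
    rw [this]; abel
  have hi : ∀ s ∈ Icc a b, IntervalIntegrable f' volume a s := fun s hs =>
    (hf'.mono (by rw [uIcc_of_le hs.1]; exact Icc_subset_Icc_right hs.2)).intervalIntegrable
  rw [← intervalIntegral.integral_interval_sub_left (hi s hs) (hi r hr), key s hs, key r hr]
  abel

/-- Global existence for linear differential equations on a compact interval. -/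
theorem exists_hasDerivWithinAt_linear [CompleteSpace E] {L : ℝ → E →L[ℝ] E} {a b : ℝ}
    (hab : a ≤ b) (hL : ContinuousOn L (Icc a b)) (y₀ : E) :
    ∃ y : ℝ → E, y a = y₀ ∧ ∀ s ∈ Icc a b, HasDerivWithinAt y (L s (y s)) (Icc a b) s := by
  obtain ⟨M, hM⟩ := isCompact_Icc.exists_bound_of_continuousOn hL
  have hM0 : 0 ≤ M := (norm_nonneg _).trans (hM a (left_mem_Icc.2 hab))
  -- Exponential weighting: the fixed-point unknown is `z = exp(-k (s - a)) y`. As `M / k ≤ 1 / 2`,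
  -- the Picard map is a `1 / 2`-contraction in the sup norm on the whole interval, with no
  -- subdivision.
  set k : ℝ := 2 * M + 1 with hk
  have hk0 : 0 < k := by positivity
  set e : ℝ → ℝ := fun s => Real.exp (k * (s - a)) with he
  have hec : Continuous e := by fun_prop
  have hepos : ∀ s, 0 < e s := fun s => Real.exp_pos _
  let I : C(Icc a b, E) → ℝ → E := fun z r => e r • L r (IccExtend hab z r)
  have hI : ∀ z, ContinuousOn (I z) (Icc a b) := fun z =>
    hec.continuousOn.smul (hL.clm_apply z.continuous.Icc_extend'.continuousOn)
  have hII : ∀ z, ∀ s ∈ Icc a b, IntervalIntegrable (I z) volume a s := fun z s hs =>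
    ((hI z).mono (by rw [uIcc_of_le hs.1]; exact Icc_subset_Icc_right hs.2)).intervalIntegrable
  have hD : ∀ z, ∀ s ∈ Icc a b,
      HasDerivWithinAt (fun σ => ∫ r in a..σ, I z r) (I z s) (Icc a b) s := fun z s hs =>
    hasDerivWithinAt_integral_Icc hab (hI z) hs
  have hcont : ∀ z, ContinuousOn (fun s => (e s)⁻¹ • (y₀ + ∫ r in a..s, I z r)) (Icc a b) :=
    fun z => (hec.continuousOn.inv₀ fun s _ => (hepos s).ne').smul
      (continuousOn_const.add fun s hs => (hD z s hs).continuousWithinAt)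
  let Φ : C(Icc a b, E) → C(Icc a b, E) := fun z =>
    ⟨_, continuousOn_iff_continuous_domRestrict.1 (hcont z)⟩
  have hΦ : ContractingWith (1 / 2) Φ := by
    refine ⟨by rw [← NNReal.coe_lt_coe]; norm_num, LipschitzWith.of_dist_le_mul fun z w => ?_⟩
    rw [dist_eq_norm, dist_eq_norm, ContinuousMap.norm_le _ (by positivity)]
    rintro ⟨s, hs⟩
    have h1 : (Φ z - Φ w) ⟨s, hs⟩ = (e s)⁻¹ • ∫ r in a..s, (I z r - I w r) := by
      rw [intervalIntegral.integral_sub (hII z s hs) (hII w s hs)]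
      simp only [ContinuousMap.sub_apply, Φ, ContinuousMap.coe_mk, domRestrict_apply, ← smul_sub]
      congr 1; abel
    have h2 : ‖∫ r in a..s, (I z r - I w r)‖ ≤ ∫ r in a..s, (M * ‖z - w‖) * e r := by
      refine intervalIntegral.norm_integral_le_of_norm_le hs.1 (ae_of_all _ fun r hr => ?_)
        ((continuous_const.mul hec).intervalIntegrable _ _)
      have hr' : r ∈ Icc a b := ⟨hr.1.le, hr.2.trans hs.2⟩
      simp only [I, IccExtend_of_mem hab _ hr', ← smul_sub, ← map_sub, norm_smul,
        Real.norm_of_nonneg (hepos r).le]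
      rw [mul_comm]
      gcongr
      refine (ContinuousLinearMap.le_opNorm _ _).trans ?_
      gcongr
      · exact hM r hr'
      · exact ContinuousMap.norm_coe_le_norm (z - w) ⟨r, hr'⟩
    have h3 : ∫ r in a..s, e r = (e s - 1) / k := by
      have : ∀ r ∈ uIcc a s, HasDerivAt (fun r => e r / k) (e r) r := fun r _ => by
        have := (((hasDerivAt_id r).sub_const a).const_mul k).exp.div_const k
        simpa [he, hk0.ne'] using this
      rw [intervalIntegral.integral_eq_sub_of_hasDerivAt this (hec.intervalIntegrable _ _)]
      simp [he, sub_div]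
    rw [intervalIntegral.integral_const_mul, h3] at h2
    rw [h1, norm_smul, norm_inv, Real.norm_of_nonneg (hepos s).le]
    rw [inv_mul_le_iff₀ (hepos s)]
    refine h2.trans ?_
    have h4 : M * ((e s - 1) / k) ≤ e s * (1 / 2) := by
      rw [mul_div_assoc', div_le_iff₀ hk0, hk]
      nlinarith [hepos s]
    calc M * ‖z - w‖ * ((e s - 1) / k) = M * ((e s - 1) / k) * ‖z - w‖ := by ring
      _ ≤ e s * (1 / 2) * ‖z - w‖ := by gcongr
      _ = _ := by push_cast; ring
  set z := hΦ.fixedPoint Φ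
  have hz : Φ z = z := hΦ.fixedPoint_isFixedPt
  have hz' : ∀ s ∈ Icc a b, y₀ + ∫ r in a..s, I z r = e s • IccExtend hab z s := by
    intro s hs
    have := congrArg (fun f => f ⟨s, hs⟩) hz
    simp only [Φ, ContinuousMap.coe_mk, domRestrict_apply] at this
    rw [IccExtend_of_mem hab _ hs, ← this, smul_inv_smul₀ (hepos s).ne']
  refine ⟨fun s => y₀ + ∫ r in a..s, I z r, by simp, fun s hs => ?_⟩
  have := (hD z s hs).const_add y₀
  convert this using 1
  show L s (y₀ + ∫ r in a..s, I z r) = I z s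
  rw [hz' s hs, map_smul]

theorem hasFDerivAt_intervalIntegral_of_continuousOn {a b : ℝ} (hab : a ≤ b) {g : ℝ → H → F}
    {g' : ℝ → H → H →L[ℝ] F} (hg : ∀ u, ContinuousOn (fun s => g s u) (Icc a b))
    (hg' : ContinuousOn (fun p : ℝ × H => g' p.1 p.2) (Icc a b ×ˢ univ))
    (hd : ∀ s ∈ Icc a b, ∀ u, HasFDerivAt (g s) (g' s u) u) (u : H) :
    HasFDerivAt (fun u => ∫ s in a..b, g s u) (∫ s in a..b, g' s u) u := by
  have hc : Continuous fun p : ℝ × H => g' (projIcc a b hab p.1) p.2 :=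
    hg'.comp_continuous (f := fun p : ℝ × H => ((projIcc a b hab p.1 : ℝ), p.2))
      ((continuous_subtype_val.comp (continuous_projIcc.comp continuous_fst)).prodMk
        continuous_snd) fun p => ⟨(projIcc a b hab p.1).2, mem_univ _⟩
  have hgu : ContinuousOn (fun s => g' s u) (Icc a b) :=
    hg'.comp (continuousOn_id.prodMk continuousOn_const) fun s hs => ⟨hs, mem_univ _⟩
  obtain ⟨C, hC⟩ := isCompact_Icc.exists_bound_of_continuousOn hgu
  -- `H` need not be locally compact. Compactness of `[a, b] × {u}` alone gives a neighbourhood `V`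
  -- of `u` on which the derivative is below `C + 1` for all times; this constant is the dominating
  -- function.
  obtain ⟨U, V, -, hV, hU, huV, hUV⟩ := generalized_tube_lemma (isCompact_Icc (a := a) (b := b))
    (isCompact_singleton (x := u))
    (isOpen_lt hc.norm (continuous_const (y := C + 1))) (by
      rintro ⟨s, v⟩ ⟨hs, rfl⟩
      simp only [mem_ofPred_eq, projIcc_of_mem hab hs]
      linarith [hC s hs])
  have hsub : uIoc a b ⊆ Icc a b := by rw [uIoc_of_le hab]; exact Ioc_subset_Icc_self
  refine intervalIntegral.hasFDerivAt_integral_of_dominated_of_fderiv_le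
    (F' := fun u s => g' s u) (bound := fun _ => C + 1)
    (hV.mem_nhds (huV rfl)) (.of_forall fun v => ?_) ?_ ?_ ?_ ?_ ?_
  · exact ((hg v).aestronglyMeasurable measurableSet_Icc).mono_set hsub
  · exact ((hg u).mono (by rw [uIcc_of_le hab])).intervalIntegrable
  · exact (hgu.aestronglyMeasurable measurableSet_Icc).mono_set hsub
  · refine ae_of_all _ fun s hs v hv => ?_
    have := hUV (mk_mem_prod (hU (hsub hs)) hv)
    simp only [mem_ofPred_eq, projIcc_of_mem hab (hsub hs)] at this
    exact this.le
  · exact intervalIntegrable_const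
  · exact ae_of_all _ fun s hs v _ => hd s (hsub hs) v

/-- The partial derivative in the space variable is the joint derivative composed with the inclusion
`h ↦ (0, h)`. Nondegeneracy `a < b` makes the product set one of unique differentiability. -/
theorem ContDiffOn.fderiv_slice {a b : ℝ} (hab : a < b) {f : ℝ → H → F} {k : ℕ}
    (hf : ContDiffOn ℝ (k + 1 : ℕ) (fun p : ℝ × H => f p.1 p.2) (Icc a b ×ˢ univ)) :
    (∀ s ∈ Icc a b, ∀ x, HasFDerivAt (f s) (fderiv ℝ (f s) x) x) ∧
      ContDiffOn ℝ k (fun p : ℝ × H => fderiv ℝ (f p.1) p.2) (Icc a b ×ˢ univ) := by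
  have hu : UniqueDiffOn ℝ (Icc a b ×ˢ (univ : Set H)) :=
    (uniqueDiffOn_Icc hab).prod uniqueDiffOn_univ
  have key : ∀ s ∈ Icc a b, ∀ x, HasFDerivAt (f s)
      ((fderivWithin ℝ (fun p : ℝ × H => f p.1 p.2) (Icc a b ×ˢ univ) (s, x)).comp
        (ContinuousLinearMap.inr ℝ ℝ H)) x := by
    intro s hs x
    have h1 := (hf.differentiableOn (by simp) (s, x) ⟨hs, mem_univ _⟩).hasFDerivWithinAt
    have h2 : HasFDerivWithinAt (fun y : H => (s, y)) (ContinuousLinearMap.inr ℝ ℝ H) univ x :=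
      (hasFDerivAt_prodMk_right s x).hasFDerivWithinAt
    have := h1.comp x h2 fun y _ => ⟨hs, mem_univ _⟩
    exact hasFDerivWithinAt_univ.1 this
  refine ⟨fun s hs x => by rw [(key s hs x).fderiv]; exact key s hs x, ?_⟩
  have h3 : ContDiffOn ℝ k (fderivWithin ℝ (fun p : ℝ × H => f p.1 p.2) (Icc a b ×ˢ univ))
      (Icc a b ×ˢ univ) := hf.fderivWithin hu (by norm_cast)
  refine (h3.clm_comp (contDiffOn_const (c := ContinuousLinearMap.inr ℝ ℝ H))).congr ?_
  rintro ⟨s, x⟩ ⟨hs, -⟩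
  exact (key s hs x).fderiv

/-- Fubini's theorem on a triangle. -/
theorem integral_integral_triangle {a b : ℝ} (hab : a ≤ b) {f : ℝ → ℝ → E}
    (hf : Integrable (fun p : ℝ × ℝ => f p.1 p.2)
      ((volume.restrict (Ioc a b)).prod (volume.restrict (Ioc a b)))) :
    ∫ r in a..b, ∫ s in r..b, f r s = ∫ s in a..b, ∫ r in a..s, f r s := by
  have hms : MeasurableSet {p : ℝ × ℝ | p.1 < p.2} := measurableSet_lt measurable_fst measurable_snd
  -- Both sides are iterated integrals over the square of `f` cut off to `r < s`.
  have h := integral_integral_swap (f := fun r s => {p : ℝ × ℝ | p.1 < p.2}.indicator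
    (fun p : ℝ × ℝ => f p.1 p.2) (r, s)) (hf.indicator hms)
  rw [intervalIntegral.integral_of_le hab, intervalIntegral.integral_of_le hab]
  convert h using 1
  · refine setIntegral_congr_fun measurableSet_Ioc fun r hr => ?_
    rw [intervalIntegral.integral_of_le hr.2,
      show (fun s => {p : ℝ × ℝ | p.1 < p.2}.indicator (fun p : ℝ × ℝ => f p.1 p.2) (r, s))
        = (Ioi r).indicator (f r) from by ext s; simp [indicator],
      setIntegral_indicator measurableSet_Ioi]
    congr 2
    ext s; simp only [mem_Ioc, mem_inter_iff, mem_Ioi]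
    exact ⟨fun h => ⟨⟨hr.1.trans h.1, h.2⟩, h.1⟩, fun h => ⟨h.2, h.1.2⟩⟩
  · refine setIntegral_congr_fun measurableSet_Ioc fun s hs => ?_
    rw [intervalIntegral.integral_of_le hs.1.le,
      show (fun r => {p : ℝ × ℝ | p.1 < p.2}.indicator (fun p : ℝ × ℝ => f p.1 p.2) (r, s))
        = (Iio s).indicator (fun r => f r s) from by ext r; simp [indicator],
      setIntegral_indicator measurableSet_Iio, integral_Ioc_eq_integral_Ioo]
    congr 2
    ext r; simp only [mem_Ioo, mem_Ioc, mem_inter_iff, mem_Iio]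
    exact ⟨fun h => ⟨⟨h.1, h.2.le.trans hs.2⟩, h.2⟩, fun h => ⟨h.1.1, h.2⟩⟩

/-- Product rule for `L w` with `w = ∫ g`. As `g` is only integrable, `w` need not be differentiable
everywhere; instead `L r = L s - ∫_r^s L'` is inserted under the integral and Fubini on the triangle
is applied. -/
theorem clm_apply_integral_eq_integral [CompleteSpace E] [CompleteSpace F] {L L' : ℝ → E →L[ℝ] F}
    {g : ℝ → E}
    {a b : ℝ} (hL : ∀ s ∈ Icc a b, HasDerivWithinAt L (L' s) (Icc a b) s)
    (hL' : ContinuousOn L' (Icc a b)) (hg : IntegrableOn g (Icc a b)) {s : ℝ}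
    (hs : s ∈ Icc a b) :
    L s (∫ r in a..s, g r) = ∫ r in a..s, (L' r (∫ σ in a..r, g σ) + L r (g r)) := by
  have hsub : Icc a s ⊆ Icc a b := Icc_subset_Icc_right hs.2
  have hsub' : Ioc a s ⊆ Icc a b := Ioc_subset_Icc_self.trans hsub
  have hLc : ContinuousOn L (Icc a b) := fun s hs => (hL s hs).continuousWithinAt
  have hgi : IntegrableOn g (Ioc a s) := hg.mono_set hsub'
  have hgii : IntervalIntegrable g volume a s :=
    (intervalIntegrable_iff_integrableOn_Ioc_of_le hs.1).2 hgi
  have happ : ∀ {K : ℝ → E →L[ℝ] F}, ContinuousOn K (Icc a b) →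
      IntervalIntegrable (fun r => K r (g r)) volume a s := by
    intro K hK
    obtain ⟨C, hC⟩ := isCompact_Icc.exists_bound_of_continuousOn hK
    rw [intervalIntegrable_iff_integrableOn_Ioc_of_le hs.1]
    refine (hgi.norm.const_mul C).mono' (isBoundedBilinearMap_apply.continuous.comp_aestronglyMeasurable
      (((hK.aestronglyMeasurable measurableSet_Icc).mono_set hsub').prodMk
        hgi.aestronglyMeasurable)) ?_
    refine (ae_restrict_iff' measurableSet_Ioc).2 (ae_of_all _ fun r hr => ?_)
    exact (ContinuousLinearMap.le_opNorm _ _).trans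
      (mul_le_mul_of_nonneg_right (hC r (hsub' hr)) (norm_nonneg _))
  have hint1 : IntervalIntegrable (fun r => L' r (∫ σ in a..r, g σ)) volume a s := by
    refine ContinuousOn.intervalIntegrable ?_
    rw [uIcc_of_le hs.1]
    refine (hL'.mono hsub).clm_apply ?_
    have := intervalIntegral.continuousOn_primitive_interval (μ := volume) (f := g) (a := a) (b := s)
      (by rw [uIcc_of_le hs.1]; exact hg.mono_set hsub)
    rwa [uIcc_of_le hs.1] at this
  rw [intervalIntegral.integral_add hint1 (happ hLc)]
  have h1 : ∫ r in a..s, L r (g r)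
      = L s (∫ r in a..s, g r) - ∫ r in a..s, ∫ σ in r..s, L' σ (g r) := by
    have hfun : ∀ r ∈ uIcc a s, ∫ σ in r..s, L' σ (g r) = L s (g r) - L r (g r) := by
      intro r hr
      rw [uIcc_of_le hs.1] at hr
      have hii : IntervalIntegrable L' volume r s := by
        refine (hL'.mono ?_).intervalIntegrable
        rw [uIcc_of_le hr.2]
        exact Icc_subset_Icc hr.1 hs.2
      rw [← ContinuousLinearMap.intervalIntegral_apply hii,
        integral_eq_sub_of_hasDerivWithinAt_Icc hL hL' (hsub hr) hs]
      rfl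
    rw [intervalIntegral.integral_congr hfun, intervalIntegral.integral_sub
      (happ continuousOn_const) (happ hLc),
      ContinuousLinearMap.intervalIntegral_comp_comm _ hgii]
    abel
  rw [h1, integral_integral_triangle hs.1]
  · have : ∀ r ∈ uIcc a s, ∫ σ in a..r, L' r (g σ) = L' r (∫ σ in a..r, g σ) := by
      intro r hr
      rw [uIcc_of_le hs.1] at hr
      refine ContinuousLinearMap.intervalIntegral_comp_comm _ ?_
      rw [intervalIntegrable_iff_integrableOn_Ioc_of_le hr.1]
      exact hgi.mono_set (Ioc_subset_Ioc_right hr.2)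
    rw [intervalIntegral.integral_congr this]
    abel
  · obtain ⟨C, hC⟩ := isCompact_Icc.exists_bound_of_continuousOn hL'
    have hmL := ((hL'.aestronglyMeasurable measurableSet_Icc).mono_set hsub' :
      AEStronglyMeasurable L' (volume.restrict (Ioc a s)))
    have hb : Integrable (fun p : ℝ × ℝ => ‖g p.1‖ * C)
        ((volume.restrict (Ioc a s)).prod (volume.restrict (Ioc a s))) :=
      hgi.norm.mul_prod (integrable_const C)
    refine hb.mono' (isBoundedBilinearMap_apply.continuous.comp_aestronglyMeasurable
      (hmL.comp_snd.prodMk hgi.aestronglyMeasurable.comp_fst)) ?_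
    rw [Measure.prod_restrict]
    refine (ae_restrict_iff' (measurableSet_Ioc.prod measurableSet_Ioc)).2
      (ae_of_all _ fun p hp => ?_)
    rw [mul_comm]
    exact (ContinuousLinearMap.le_opNorm _ _).trans
      (mul_le_mul_of_nonneg_right (hC _ (hsub' hp.2)) (norm_nonneg _))

/-- The Cauchy–Schwarz inequality for integrals of real functions. -/
theorem integral_mul_le_sqrt_mul_sqrt {X : Type*} [MeasurableSpace X] {μ : Measure X}
    {f g : X → ℝ} (hf0 : ∀ x, 0 ≤ f x) (hg0 : ∀ x, 0 ≤ g x) (hf : MemLp f 2 μ)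
    (hg : MemLp g 2 μ) :
    ∫ x, f x * g x ∂μ ≤ √(∫ x, f x ^ 2 ∂μ) * √(∫ x, g x ^ 2 ∂μ) := by
  have := integral_mul_le_Lp_mul_Lq_of_nonneg (μ := μ) (p := 2) (q := 2)
    Real.HolderConjugate.two_two (ae_of_all _ hf0) (ae_of_all _ hg0)
    (by simpa using hf) (by simpa using hg)
  simpa [Real.sqrt_eq_rpow] using this

end Auxiliary

/-! ### The flow of the linear equation and the fundamental matrix. -/

/-- `Ψ` solves `Ψ' = A Ψ` on `[t, T]` with `Ψ(t) = I`, and `Ξ` is its pointwise inverse. -/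
structure IsFlowPair {n : ℕ} (A : ℝ → (Vec n →L[ℝ] Vec n)) (t T : ℝ)
    (Ψ Ξ : ℝ → (Vec n →L[ℝ] Vec n)) : Prop where
  left_init : Ψ t = ContinuousLinearMap.id ℝ (Vec n)
  right_init : Ξ t = ContinuousLinearMap.id ℝ (Vec n)
  hasDeriv_left : ∀ s ∈ Icc t T, HasDerivWithinAt Ψ (A s ∘L Ψ s) (Icc t T) s
  hasDeriv_right : ∀ s ∈ Icc t T, HasDerivWithinAt Ξ (-(Ξ s ∘L A s)) (Icc t T) s
  mul_right : ∀ s ∈ Icc t T, Ψ s ∘L Ξ s = ContinuousLinearMap.id ℝ (Vec n)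

theorem exists_isFlowPair {n : ℕ} {A : ℝ → (Vec n →L[ℝ] Vec n)} {t T : ℝ} (htT : t ≤ T)
    (hA : ContinuousOn A (Icc t T)) : ∃ Ψ Ξ, IsFlowPair A t T Ψ Ξ := by
  let c := ContinuousLinearMap.compL ℝ (Vec n) (Vec n) (Vec n)
  obtain ⟨Ψ, hΨ0, hΨ⟩ := exists_hasDerivWithinAt_linear htT
    (c.continuous.comp_continuousOn hA) (ContinuousLinearMap.id ℝ (Vec n))
  obtain ⟨Ξ, hΞ0, hΞ⟩ := exists_hasDerivWithinAt_linear htT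
    (c.flip.continuous.comp_continuousOn hA).neg (ContinuousLinearMap.id ℝ (Vec n))
  have hΨ' : ∀ s ∈ Icc t T, HasDerivWithinAt Ψ (A s ∘L Ψ s) (Icc t T) s := hΨ
  have hΞ' : ∀ s ∈ Icc t T, HasDerivWithinAt Ξ (-(Ξ s ∘L A s)) (Icc t T) s := hΞ
  refine ⟨Ψ, Ξ, hΨ0, hΞ0, hΨ', hΞ', fun s hs => ?_⟩
  have h : Ξ s ∘L Ψ s = ContinuousLinearMap.id ℝ (Vec n) := by
    have := eq_left_of_hasDerivWithinAt_zero (f := fun s => Ξ s ∘L Ψ s) (fun r hr => by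
      refine ((hΞ' r hr).clm_comp (hΨ' r hr)).congr_deriv ?_
      ext1 v; simp) hs
    rw [this, hΨ0, hΞ0]; rfl
  -- In finite dimension a left inverse is a right inverse.
  have h2 : (Ξ s : Vec n →ₗ[ℝ] Vec n) * (Ψ s : Vec n →ₗ[ℝ] Vec n) = 1 := by
    ext1 v; exact congrArg (fun f => f v) h
  have h3 := mul_eq_one_comm.1 h2
  ext1 v
  exact congrArg (fun f => f v) h3

namespace IsFlowPair

variable {n m : ℕ} {A : ℝ → (Vec n →L[ℝ] Vec n)} {t T : ℝ} {Ψ Ξ : ℝ → (Vec n →L[ℝ] Vec n)}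

theorem continuousOn_left (h : IsFlowPair A t T Ψ Ξ) : ContinuousOn Ψ (Icc t T) :=
  fun s hs => (h.hasDeriv_left s hs).continuousWithinAt

theorem continuousOn_right (h : IsFlowPair A t T Ψ Ξ) : ContinuousOn Ξ (Icc t T) :=
  fun s hs => (h.hasDeriv_right s hs).continuousWithinAt

theorem isFundamentalMatrix (h : IsFlowPair A t T Ψ Ξ) :
    IsFundamentalMatrix A t T fun s τ => Ψ s ∘L Ξ τ := by
  refine fun τ hτ => ⟨h.mul_right τ hτ, fun s hs => ?_⟩
  have := ((h.hasDeriv_left s ⟨hτ.1.trans hs.1, hs.2⟩).mono (Icc_subset_Icc_left hτ.1)).clm_comp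
    (hasDerivWithinAt_const s (Icc τ T) (Ξ τ))
  convert this using 1
  ext; simp

/-- `fundamentalMatrix` is a chosen object. It is identified through `Ξ(s) Φ(s, τ)`, which has zero
derivative in `s` and so equals `Ξ(τ)`. -/
theorem fundamentalMatrix_eq (h : IsFlowPair A t T Ψ Ξ) {s τ : ℝ} (hτ : t ≤ τ) (hs : τ ≤ s)
    (hT : s ≤ T) : fundamentalMatrix A t T s τ = Ψ s ∘L Ξ τ := by
  have hex : ∃ Φ, IsFundamentalMatrix A t T Φ := ⟨_, h.isFundamentalMatrix⟩
  have hΦ : IsFundamentalMatrix A t T (fundamentalMatrix A t T) := by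
    rw [fundamentalMatrix, dif_pos hex]; exact hex.choose_spec
  obtain ⟨h0, h1⟩ := hΦ τ ⟨hτ, hs.trans hT⟩
  have := eq_left_of_hasDerivWithinAt_zero (a := τ) (b := T)
    (f := fun s => Ξ s ∘L fundamentalMatrix A t T s τ) (fun r hr => by
      refine (((h.hasDeriv_right r ⟨hτ.trans hr.1, hr.2⟩).mono
        (Icc_subset_Icc_left hτ)).clm_comp (h1 r hr)).congr_deriv ?_
      ext1 v; simp) ⟨hs, hT⟩
  simp only [h0] at this
  have h2 := congrArg (fun L => Ψ s ∘L L) this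
  simp only [← ContinuousLinearMap.comp_assoc, h.mul_right s ⟨hτ.trans hs, hT⟩] at h2
  simpa using h2

theorem eq_zero_of_hasDerivWithinAt (h : IsFlowPair A t T Ψ Ξ) {Z : ℝ → Vec n} (hZ0 : Z t = 0)
    (hZ : ∀ s ∈ Icc t T, HasDerivWithinAt Z (A s (Z s)) (Icc t T) s) {s : ℝ}
    (hs : s ∈ Icc t T) : Z s = 0 := by
  have := eq_left_of_hasDerivWithinAt_zero (f := fun s => Ξ s (Z s)) (fun r hr => by
    convert (h.hasDeriv_right r hr).clm_apply (hZ r hr) using 1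
    simp) hs
  simp only [hZ0, map_zero] at this
  have h2 := congrArg (fun L => L (Z s)) (h.mul_right s hs)
  simp only [ContinuousLinearMap.comp_apply, this, map_zero, ContinuousLinearMap.id_apply] at h2
  exact h2.symm

end IsFlowPair

/-! ### Square-integrable controls and their primitives. -/

section Control

variable {m : ℕ} {t T : ℝ} {W : Type*} [NormedAddCommGroup W] [NormedSpace ℝ W]

theorem Control.integrableOn (u : Control m t T) : IntegrableOn (fun s => u s) (Icc t T) :=
  (Lp.memLp u).integrable one_le_two

theorem Control.integrableOn_norm_sq (u : Control m t T) :
    IntegrableOn (fun s => ‖u s‖ ^ 2) (Icc t T) :=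
  (Lp.memLp u).integrable_norm_pow (by norm_num)

theorem Control.norm_sq_eq (htT : t ≤ T) (u : Control m t T) :
    ‖u‖ ^ 2 = ∫ s in t..T, ‖u s‖ ^ 2 := by
  rw [← real_inner_self_eq_norm_sq, L2.inner_def, intervalIntegral.integral_of_le htT,
    integral_Icc_eq_integral_Ioc]
  simp

theorem Control.norm_eq (htT : t ≤ T) (u : Control m t T) :
    ‖u‖ = √(∫ s in t..T, ‖u s‖ ^ 2) := by
  rw [← Control.norm_sq_eq htT, Real.sqrt_sq (norm_nonneg _)]

theorem Control.memLp_norm (u : Control m t T) {a b : ℝ} (ha : t ≤ a) (hb : b ≤ T) :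
    MemLp (fun s => ‖u s‖) 2 (volume.restrict (Ioc a b)) :=
  ((Lp.memLp u).mono_measure (Measure.restrict_mono
    (Ioc_subset_Icc_self.trans (Icc_subset_Icc ha hb)) le_rfl)).norm

theorem Control.integral_norm_sq_le (u : Control m t T) {a b : ℝ} (ha : t ≤ a) (hab : a ≤ b)
    (hb : b ≤ T) : ∫ s in a..b, ‖u s‖ ^ 2 ≤ ‖u‖ ^ 2 := by
  rw [Control.norm_sq_eq (ha.trans (hab.trans hb)), intervalIntegral.integral_of_le hab,
    intervalIntegral.integral_of_le (ha.trans (hab.trans hb))]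
  exact setIntegral_mono_set (u.integrableOn_norm_sq.mono_set Ioc_subset_Icc_self)
    (ae_of_all _ fun _ => by positivity) (Ioc_subset_Ioc ha hb).eventuallyLE

theorem Control.integral_norm_mul_norm_le (htT : t ≤ T) (u v : Control m t T) :
    ∫ s in t..T, ‖u s‖ * ‖v s‖ ≤ ‖u‖ * ‖v‖ := by
  rw [Control.norm_eq htT u, Control.norm_eq htT v]
  simp only [intervalIntegral.integral_of_le htT]
  exact integral_mul_le_sqrt_mul_sqrt (fun _ => norm_nonneg _) (fun _ => norm_nonneg _)
    (u.memLp_norm le_rfl le_rfl) (v.memLp_norm le_rfl le_rfl)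

theorem Control.integral_norm_le (u : Control m t T) {a b : ℝ} (ha : t ≤ a) (hab : a ≤ b)
    (hb : b ≤ T) : ∫ s in a..b, ‖u s‖ ≤ √(b - a) * ‖u‖ := by
  have h := integral_mul_le_sqrt_mul_sqrt (μ := volume.restrict (Ioc a b)) (f := fun _ => 1)
    (fun _ => zero_le_one) (fun _ => norm_nonneg _) (memLp_const 1) (u.memLp_norm ha hb)
  simp only [one_mul, one_pow, ← intervalIntegral.integral_of_le hab,
    intervalIntegral.integral_const, smul_eq_mul, mul_one] at h
  refine h.trans ?_
  gcongr
  rw [Real.sqrt_le_left (norm_nonneg _)]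
  exact u.integral_norm_sq_le ha hab hb

theorem Control.ae_add (u v : Control m t T) :
    ∀ᵐ s ∂volume.restrict (Ioc t T), (u + v) s = u s + v s :=
  ae_restrict_of_ae_restrict_of_subset Ioc_subset_Icc_self (Lp.coeFn_add u v)

theorem Control.ae_smul (c : ℝ) (v : Control m t T) :
    ∀ᵐ s ∂volume.restrict (Ioc t T), (c • v) s = c • v s :=
  ae_restrict_of_ae_restrict_of_subset Ioc_subset_Icc_self (Lp.coeFn_smul c v)

theorem Control.integrableOn_clm_apply {C : ℝ → (Vec m →L[ℝ] W)} (hC : ContinuousOn C (Icc t T))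
    (u : Control m t T) : IntegrableOn (fun r => C r (u r)) (Icc t T) := by
  obtain ⟨M, hM⟩ := isCompact_Icc.exists_bound_of_continuousOn hC
  refine (u.integrableOn.norm.const_mul M).mono'
    (isBoundedBilinearMap_apply.continuous.comp_aestronglyMeasurable
      ((hC.aestronglyMeasurable measurableSet_Icc).prodMk u.integrableOn.aestronglyMeasurable)) ?_
  refine (ae_restrict_iff' measurableSet_Icc).2 (ae_of_all _ fun r hr => ?_)
  exact (ContinuousLinearMap.le_opNorm _ _).trans
    (mul_le_mul_of_nonneg_right (hM r hr) (norm_nonneg _))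

theorem Control.intervalIntegrable_clm_apply {C : ℝ → (Vec m →L[ℝ] W)}
    (hC : ContinuousOn C (Icc t T)) (u : Control m t T) {a b : ℝ} (ha : t ≤ a) (hab : a ≤ b)
    (hb : b ≤ T) : IntervalIntegrable (fun r => C r (u r)) volume a b :=
  (intervalIntegrable_iff_integrableOn_Ioc_of_le hab).2
    ((u.integrableOn_clm_apply hC).mono_set (Ioc_subset_Icc_self.trans (Icc_subset_Icc ha hb)))

theorem Control.norm_integral_clm_apply_le {C : ℝ → (Vec m →L[ℝ] W)} {M : ℝ} (hM0 : 0 ≤ M)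
    (hM : ∀ r ∈ Icc t T, ‖C r‖ ≤ M) (u : Control m t T) {a b : ℝ} (ha : t ≤ a) (hab : a ≤ b)
    (hb : b ≤ T) : ‖∫ r in a..b, C r (u r)‖ ≤ M * √(b - a) * ‖u‖ := by
  calc ‖∫ r in a..b, C r (u r)‖ ≤ ∫ r in a..b, M * ‖u r‖ := by
        refine intervalIntegral.norm_integral_le_of_norm_le hab (ae_of_all _ fun r hr => ?_) ?_
        · exact (ContinuousLinearMap.le_opNorm _ _).trans (mul_le_mul_of_nonneg_right
            (hM r ⟨ha.trans hr.1.le, hr.2.trans hb⟩) (norm_nonneg _))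
        · rw [intervalIntegrable_iff_integrableOn_Ioc_of_le hab]
          exact (u.integrableOn.mono_set
            (Ioc_subset_Icc_self.trans (Icc_subset_Icc ha hb))).norm.const_mul M
    _ = M * ∫ r in a..b, ‖u r‖ := intervalIntegral.integral_const_mul _ _
    _ ≤ M * (√(b - a) * ‖u‖) := by gcongr; exact u.integral_norm_le ha hab hb
    _ = _ := by ring

/-- The operators `u ↦ ∫_t^s C(r) u(r) dr` are bounded on `L²` and depend continuously on `s`. -/
theorem Control.exists_primitive {C : ℝ → (Vec m →L[ℝ] W)}
    (hC : ContinuousOn C (Icc t T)) :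
    ∃ N : ℝ → Control m t T →L[ℝ] W, ContinuousOn N (Icc t T) ∧
      ∀ s ∈ Icc t T, ∀ u, N s u = ∫ r in t..s, C r (u r) := by
  obtain ⟨M, hM⟩ := isCompact_Icc.exists_bound_of_continuousOn hC
  have hM' : ∀ r ∈ Icc t T, ‖C r‖ ≤ |M| := fun r hr => (hM r hr).trans (le_abs_self M)
  have hex : ∀ s : ℝ, ∃ N : Control m t T →L[ℝ] W,
      s ∈ Icc t T → ∀ u, N u = ∫ r in t..s, C r (u r) := by
    intro s
    by_cases hs : s ∈ Icc t T
    swap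
    · exact ⟨0, fun h => absurd h hs⟩
    have hsub : Ioc t s ⊆ Ioc t T := Ioc_subset_Ioc_right hs.2
    refine ⟨LinearMap.mkContinuous
      { toFun := fun u => ∫ r in t..s, C r (u r)
        map_add' := fun u v => ?_
        map_smul' := fun c u => ?_ } (|M| * √(s - t)) fun u =>
          u.norm_integral_clm_apply_le (abs_nonneg M) hM' le_rfl hs.1 hs.2, fun _ u => rfl⟩
    · rw [← intervalIntegral.integral_add (u.intervalIntegrable_clm_apply hC le_rfl hs.1 hs.2)
        (v.intervalIntegrable_clm_apply hC le_rfl hs.1 hs.2)]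
      simp only [intervalIntegral.integral_of_le hs.1]
      refine integral_congr_ae ?_
      filter_upwards [ae_restrict_of_ae_restrict_of_subset hsub (Control.ae_add u v)] with r hr
      rw [hr, map_add]
    · simp only [RingHom.id_apply]
      rw [← intervalIntegral.integral_smul]
      simp only [intervalIntegral.integral_of_le hs.1]
      refine integral_congr_ae ?_
      filter_upwards [ae_restrict_of_ae_restrict_of_subset hsub (Control.ae_smul c u)] with r hr
      rw [hr, map_smul]
  choose N hN using hex
  -- Cauchy–Schwarz makes the primitive Hölder-`1/2` in time in operator norm, hence norm
  -- continuous.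
  have hb : ∀ a ∈ Icc t T, ∀ b ∈ Icc t T, a ≤ b → ‖N b - N a‖ ≤ |M| * √(b - a) := by
    intro a ha b hb hab
    refine ContinuousLinearMap.opNorm_le_bound _ (by positivity) fun u => ?_
    rw [sub_apply, hN a ha, hN b hb,
      intervalIntegral.integral_interval_sub_left
        (u.intervalIntegrable_clm_apply hC le_rfl hb.1 hb.2)
        (u.intervalIntegrable_clm_apply hC le_rfl ha.1 ha.2)]
    exact u.norm_integral_clm_apply_le (abs_nonneg M) hM' ha.1 hab hb.2
  refine ⟨N, fun s hs => ?_, hN⟩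
  rw [ContinuousWithinAt, tendsto_iff_norm_sub_tendsto_zero]
  have hlim : Filter.Tendsto (fun σ => |M| * √|σ - s|) (nhdsWithin s (Icc t T)) (nhds 0) := by
    have : Continuous fun σ => |M| * √|σ - s| := by fun_prop
    simpa using (this.tendsto s).mono_left nhdsWithin_le_nhds
  refine tendsto_of_tendsto_of_tendsto_of_le_of_le' tendsto_const_nhds hlim
    (.of_forall fun _ => norm_nonneg _) ?_
  filter_upwards [self_mem_nhdsWithin] with σ hσ
  rcases le_total s σ with h | h
  · rw [abs_of_nonneg (sub_nonneg.2 h)]; exact hb s hs σ hσ h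
  · rw [norm_sub_rev, abs_sub_comm, abs_of_nonneg (sub_nonneg.2 h)]; exact hb σ hσ s hs h

end Control

/-! ### Well-posedness of the state equation. -/

namespace AQProblem

variable {n m : ℕ} {P : AQProblem n m} {t T : ℝ} {A : ℝ → (Vec n →L[ℝ] Vec n)}
  {B : ℝ → (Vec m →L[ℝ] Vec n)} {Ψ Ξ : ℝ → (Vec n →L[ℝ] Vec n)}

/-- Variation of constants. -/
theorem isTrajectory_of_isFlowPair (htT : t ≤ T) (hF : IsFlowPair A t T Ψ Ξ)
    (hAc : ContinuousOn A (Icc t T)) (hBc : ContinuousOn B (Icc t T))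
    (hA : ∀ s ∈ Icc t T, ∀ x, P.A s x = A s x) (hB : ∀ s ∈ Icc t T, ∀ x, P.B s x = B s)
    (x : Vec n) (u : Control m t T) :
    P.IsTrajectory t T x u fun s => Ψ s (x + ∫ r in t..s, Ξ r (B r (u r))) := by
  have hC : ContinuousOn (fun r => Ξ r ∘L B r) (Icc t T) := hF.continuousOn_right.clm_comp hBc
  have hg : IntegrableOn (fun r => Ξ r (B r (u r))) (Icc t T) := u.integrableOn_clm_apply hC
  have hw : ContinuousOn (fun s => ∫ r in t..s, Ξ r (B r (u r))) (Icc t T) := by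
    have := intervalIntegral.continuousOn_primitive_interval (μ := volume)
      (f := fun r => Ξ r (B r (u r))) (a := t) (b := T) (by rwa [uIcc_of_le htT])
    rwa [uIcc_of_le htT] at this
  have hX : ContinuousOn (fun s => Ψ s (x + ∫ r in t..s, Ξ r (B r (u r)))) (Icc t T) :=
    hF.continuousOn_left.clm_apply (continuousOn_const.add hw)
  have hAX := hAc.clm_apply hX
  have hdrift : ∀ s ∈ Icc t T, IntervalIntegrable
      (fun r => A r (Ψ r (x + ∫ σ in t..r, Ξ σ (B σ (u σ))))) volume t s := fun s hs =>
    (hAX.mono (by rw [uIcc_of_le hs.1]; exact Icc_subset_Icc_right hs.2)).intervalIntegrable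
  have hBu := fun s (hs : s ∈ Icc t T) =>
    u.intervalIntegrable_clm_apply hBc le_rfl hs.1 hs.2
  have hcongr : ∀ r ∈ Icc t T, P.A r (Ψ r (x + ∫ σ in t..r, Ξ σ (B σ (u σ))))
      + P.B r (Ψ r (x + ∫ σ in t..r, Ξ σ (B σ (u σ)))) (u r)
      = A r (Ψ r (x + ∫ σ in t..r, Ξ σ (B σ (u σ)))) + B r (u r) := fun r hr => by
    rw [hA r hr, hB r hr]
  refine ⟨hX, ?_, fun s hs => ?_⟩
  · refine ((hdrift T (right_mem_Icc.2 htT)).add (hBu T (right_mem_Icc.2 htT))).congr ?_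
    intro r hr
    rw [uIoc_of_le htT] at hr
    exact (hcongr r (Ioc_subset_Icc_self hr)).symm
  · rw [intervalIntegral.integral_congr (g := fun r =>
      A r (Ψ r (x + ∫ σ in t..r, Ξ σ (B σ (u σ)))) + B r (u r)) fun r hr => by
        rw [uIcc_of_le hs.1] at hr
        exact hcongr r ⟨hr.1, hr.2.trans hs.2⟩]
    -- `h1` and `h2` integrate the derivatives of `Ψ ∫ Ξ B u` and of `Ψ x`; afterwards `Ψ Ξ = I`
    -- turns `Ψ Ξ B u` into the control term `B u`.
    have h1 := clm_apply_integral_eq_integral hF.hasDeriv_left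
      (hAc.clm_comp hF.continuousOn_left) hg hs
    have h2 := integral_eq_sub_of_hasDerivWithinAt_Icc (fun r hr =>
      (hF.hasDeriv_left r hr).clm_apply (hasDerivWithinAt_const r (Icc t T) x))
      (by simpa using (hAc.clm_comp hF.continuousOn_left).clm_apply continuousOn_const)
      (left_mem_Icc.2 htT) hs
    simp only [map_zero, add_zero, hF.left_init, ContinuousLinearMap.id_apply] at h2
    beta_reduce
    rw [map_add, h1, eq_add_of_sub_eq h2.symm, add_right_comm, add_comm _ x,
      ← intervalIntegral.integral_add]
    · congr 1
      refine intervalIntegral.integral_congr fun r hr => ?_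
      rw [uIcc_of_le hs.1] at hr
      have h3 := congrArg (fun L => L (B r (u r))) (hF.mul_right r ⟨hr.1, hr.2.trans hs.2⟩)
      simp only [ContinuousLinearMap.comp_apply, ContinuousLinearMap.id_apply] at h3
      simp only [ContinuousLinearMap.comp_apply, h3, map_add]
      abel
    · refine ContinuousOn.intervalIntegrable ?_
      rw [uIcc_of_le hs.1]
      exact ((hAc.clm_comp hF.continuousOn_left).clm_apply continuousOn_const).mono
        (Icc_subset_Icc_right hs.2)
    · refine IntervalIntegrable.add (ContinuousOn.intervalIntegrable ?_)
        (u.intervalIntegrable_clm_apply (hF.continuousOn_left.clm_comp hC) le_rfl hs.1 hs.2)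
      rw [uIcc_of_le hs.1]
      exact ((hAc.clm_comp hF.continuousOn_left).clm_apply hw).mono (Icc_subset_Icc_right hs.2)

/-- The control term is independent of the state and cancels in the difference of two solutions,
which then solves the homogeneous equation with zero initial value. -/
theorem IsTrajectory.eqOn (htT : t ≤ T) (hF : IsFlowPair A t T Ψ Ξ)
    (hAc : ContinuousOn A (Icc t T))
    (hA : ∀ s ∈ Icc t T, ∀ x, P.A s x = A s x) (hB : ∀ s ∈ Icc t T, ∀ x, P.B s x = B s)
    {x : Vec n} {u : Control m t T} {X X' : ℝ → Vec n} (h : P.IsTrajectory t T x u X)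
    (h' : P.IsTrajectory t T x u X') : EqOn X' X (Icc t T) := by
  have hZ : ∀ s ∈ Icc t T, X' s - X s = ∫ r in t..s, A r (X' r - X r) := by
    intro s hs
    have hsub : uIcc t s ⊆ uIcc t T := by
      rw [uIcc_of_le hs.1, uIcc_of_le htT]; exact Icc_subset_Icc_right hs.2
    rw [h.2.2 s hs, h'.2.2 s hs, add_sub_add_left_eq_sub,
      ← intervalIntegral.integral_sub (h'.2.1.mono_set hsub) (h.2.1.mono_set hsub)]
    refine intervalIntegral.integral_congr fun r hr => ?_
    have hr' := hsub hr
    rw [uIcc_of_le htT] at hr'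
    simp only [hA r hr', hB r hr', map_sub]
    abel
  intro s hs
  refine sub_eq_zero.1 (hF.eq_zero_of_hasDerivWithinAt (Z := fun s => X' s - X s) ?_ ?_ hs)
  · simpa using hZ t (left_mem_Icc.2 htT)
  · exact fun r hr => (hasDerivWithinAt_integral_Icc htT (hAc.clm_apply (h'.1.sub h.1)) hr).congr
      hZ (hZ r hr)

theorem trajectory_eqOn (htT : t ≤ T) (hF : IsFlowPair A t T Ψ Ξ)
    (hAc : ContinuousOn A (Icc t T))
    (hA : ∀ s ∈ Icc t T, ∀ x, P.A s x = A s x) (hB : ∀ s ∈ Icc t T, ∀ x, P.B s x = B s)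
    {x : Vec n} {u : Control m t T} {X : ℝ → Vec n} (h : P.IsTrajectory t T x u X) :
    EqOn (P.trajectory t T x u) X (Icc t T) := by
  have hex : ∃ X, P.IsTrajectory t T x u X := ⟨X, h⟩
  rw [trajectory, dif_pos hex]
  exact h.eqOn htT hF hAc hA hB hex.choose_spec

end AQProblem

/-! ### Second derivatives of the three pieces of the cost. -/

section TwiceDifferentiable

variable {H V : Type*} [NormedAddCommGroup H] [NormedSpace ℝ H] [NormedAddCommGroup V]
  [NormedSpace ℝ V]

theorem HasFDerivAt.clm_comp_affine {F G : Type*} [NormedAddCommGroup F] [NormedSpace ℝ F]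
    [NormedAddCommGroup G] [NormedSpace ℝ G] {f : V → F} {f' : V →L[ℝ] F} {x₀ : V}
    {Y : H →L[ℝ] V} {u : H} (hf : HasFDerivAt f f' (x₀ + Y u)) (c : F →L[ℝ] G) :
    HasFDerivAt (fun u => c (f (x₀ + Y u))) (c ∘L (f' ∘L Y)) u :=
  c.hasFDerivAt.comp u (hf.comp u (Y.hasFDerivAt.const_add x₀))

theorem ContinuousOn.slice {E G : Type*} [TopologicalSpace E] [TopologicalSpace G] {I : Set ℝ}
    {g : ℝ → E → G} (hg : ContinuousOn (fun p : ℝ × E => g p.1 p.2) (I ×ˢ univ)) (u : E) :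
    ContinuousOn (fun s => g s u) I :=
  hg.comp (continuousOn_id.prodMk continuousOn_const) fun _ hs => ⟨hs, mem_univ _⟩

/-- Precomposition of functionals, as a bounded bilinear map. -/
def precompFunctional (H V : Type*) [NormedAddCommGroup H] [NormedSpace ℝ H]
    [NormedAddCommGroup V] [NormedSpace ℝ V] :
    (H →L[ℝ] V) →L[ℝ] (V →L[ℝ] ℝ) →L[ℝ] (H →L[ℝ] ℝ) :=
  (ContinuousLinearMap.compL ℝ H V ℝ).flip

/-- The integral functional `u ↦ ∫ q(s, X₀(s) + Y(s) u) ds` is twice Fréchet differentiable. -/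
theorem exists_hasFDerivAt_fderiv_integral {a b : ℝ} (hab : a ≤ b) {q : ℝ → V → ℝ}
    (hq : ContinuousOn (fun p : ℝ × V => q p.1 p.2) (Icc a b ×ˢ univ))
    (hq1 : ContinuousOn (fun p : ℝ × V => fderiv ℝ (q p.1) p.2) (Icc a b ×ˢ univ))
    (hq2 : ContinuousOn (fun p : ℝ × V => fderiv ℝ (fderiv ℝ (q p.1)) p.2) (Icc a b ×ˢ univ))
    (hd1 : ∀ s ∈ Icc a b, ∀ x, HasFDerivAt (q s) (fderiv ℝ (q s) x) x)
    (hd2 : ∀ s ∈ Icc a b, ∀ x, HasFDerivAt (fderiv ℝ (q s)) (fderiv ℝ (fderiv ℝ (q s)) x) x)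
    {X₀ : ℝ → V} {Y : ℝ → H →L[ℝ] V} (hX₀ : ContinuousOn X₀ (Icc a b))
    (hY : ContinuousOn Y (Icc a b)) :
    ∃ (D : H → H →L[ℝ] ℝ) (D₂ : H → H →L[ℝ] H →L[ℝ] ℝ),
      (∀ u, HasFDerivAt (fun u => ∫ s in a..b, q s (X₀ s + Y s u)) (D u) u) ∧
      (∀ u, HasFDerivAt D (D₂ u) u) ∧
      ∀ u v w, D₂ u v w = ∫ s in a..b,
        fderiv ℝ (fderiv ℝ (q s)) (X₀ s + Y s u) (Y s v) (Y s w) := by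
  have hX : ContinuousOn (fun p : ℝ × H => (p.1, X₀ p.1 + Y p.1 p.2)) (Icc a b ×ˢ univ) :=
    continuousOn_fst.prodMk ((hX₀.comp continuousOn_fst fun p hp => hp.1).add
      ((hY.comp continuousOn_fst fun p hp => hp.1).clm_apply continuousOn_snd))
  have hmaps : MapsTo (fun p : ℝ × H => (p.1, X₀ p.1 + Y p.1 p.2)) (Icc a b ×ˢ univ)
    (Icc a b ×ˢ univ) := fun p hp => ⟨hp.1, mem_univ _⟩
  have hY' : ContinuousOn (fun p : ℝ × H => Y p.1) (Icc a b ×ˢ univ) :=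
    hY.comp continuousOn_fst fun p hp => hp.1
  have hdX : ∀ s u, HasFDerivAt (fun u => X₀ s + Y s u) (Y s) u := fun s u =>
    (Y s).hasFDerivAt.const_add _
  let c := precompFunctional H V
  let g₁ : ℝ → H → (H →L[ℝ] ℝ) := fun s u => c (Y s) (fderiv ℝ (q s) (X₀ s + Y s u))
  let g₂ : ℝ → H → (H →L[ℝ] (H →L[ℝ] ℝ)) := fun s u =>
    c (Y s) ∘L (fderiv ℝ (fderiv ℝ (q s)) (X₀ s + Y s u) ∘L Y s)
  have hc1 : ContinuousOn (fun p : ℝ × H => g₁ p.1 p.2) (Icc a b ×ˢ univ) :=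
    (c.continuous.comp_continuousOn hY').clm_apply (hq1.comp hX hmaps)
  have hc2 : ContinuousOn (fun p : ℝ × H => g₂ p.1 p.2) (Icc a b ×ˢ univ) :=
    (c.continuous.comp_continuousOn hY').clm_comp ((hq2.comp hX hmaps).clm_comp hY')
  have hg₁ : ∀ s ∈ Icc a b, ∀ u, HasFDerivAt (g₁ s) (g₂ s u) u := fun s hs u =>
    (hd2 s hs _).clm_comp_affine (c (Y s))
  have hval : ∀ s u v w, g₂ s u v w = fderiv ℝ (fderiv ℝ (q s)) (X₀ s + Y s u) (Y s v) (Y s w) :=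
    fun _ _ _ _ => rfl
  have hqX : ∀ s ∈ Icc a b, ∀ u, HasFDerivAt (fun u => q s (X₀ s + Y s u)) (g₁ s u) u :=
    fun s hs u => (hd1 s hs _).comp u (hdX s u)
  clear_value g₁ g₂
  have hg₂v : ∀ u, ContinuousOn (fun s => g₂ s u) (uIcc a b) := fun u => by
    rw [uIcc_of_le hab]
    exact hc2.slice u
  refine ⟨fun u => ∫ s in a..b, g₁ s u, fun u => ∫ s in a..b, g₂ s u, fun u => ?_, fun u => ?_,
    fun u v w => ?_⟩
  · exact hasFDerivAt_intervalIntegral_of_continuousOn hab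
      (fun u => (ContinuousOn.slice (g := fun s u => q s (X₀ s + Y s u)) (hq.comp hX hmaps) u))
      hc1 hqX u
  · exact hasFDerivAt_intervalIntegral_of_continuousOn hab hc1.slice hc2 hg₁ u
  · have h1 : (∫ s in a..b, g₂ s u) v = ∫ s in a..b, g₂ s u v :=
      ContinuousLinearMap.intervalIntegral_apply (hg₂v u).intervalIntegrable v
    have h2 : (∫ s in a..b, g₂ s u v) w = ∫ s in a..b, g₂ s u v w :=
      ContinuousLinearMap.intervalIntegral_apply
        ((hg₂v u).clm_apply continuousOn_const).intervalIntegrable w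
    rw [h1, h2]
    simp only [hval]

theorem exists_hasFDerivAt_fderiv_comp_affine {g : V → ℝ} (hg : ContDiff ℝ 2 g) (x₀ : V)
    (L : H →L[ℝ] V) :
    ∃ (D : H → H →L[ℝ] ℝ) (D₂ : H → H →L[ℝ] H →L[ℝ] ℝ),
      (∀ u, HasFDerivAt (fun u => g (x₀ + L u)) (D u) u) ∧
      (∀ u, HasFDerivAt D (D₂ u) u) ∧
      ∀ u v w, D₂ u v w = fderiv ℝ (fderiv ℝ g) (x₀ + L u) (L v) (L w) := by
  let c := precompFunctional H V
  have hdX : ∀ u, HasFDerivAt (fun u => x₀ + L u) L u := fun u => L.hasFDerivAt.const_add _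
  have hg1 : Differentiable ℝ g := hg.differentiable (by norm_num)
  have hg2 : Differentiable ℝ (fderiv ℝ g) :=
    (hg.fderiv_right (m := 1) (by norm_num)).differentiable (by norm_num)
  exact ⟨fun u => fderiv ℝ g (x₀ + L u) ∘L L,
    fun u => c L ∘L (fderiv ℝ (fderiv ℝ g) (x₀ + L u) ∘L L),
    fun u => (hg1 _).hasFDerivAt.comp u (hdX u),
    fun u => (hg2 _).hasFDerivAt.clm_comp_affine (c L), fun u v w => rfl⟩

/-- The form `b` is not assumed symmetric: the one used below contains `⟨S Y u, v⟩`. The second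
derivative is thus its symmetrization, with value `2 b(v, v)` on the diagonal. -/
theorem exists_hasFDerivAt_fderiv_quadratic (l : H →L[ℝ] ℝ) (b : H →L[ℝ] H →L[ℝ] ℝ) :
    ∃ (D : H → H →L[ℝ] ℝ) (D₂ : H → H →L[ℝ] H →L[ℝ] ℝ),
      (∀ u, HasFDerivAt (fun u => l u + b u u) (D u) u) ∧
      (∀ u, HasFDerivAt D (D₂ u) u) ∧ ∀ u v w, D₂ u v w = b v w + b w v := by
  refine ⟨fun u => l + (b + b.flip) u, fun _ => b + b.flip, fun u => ?_,
    fun u => (b + b.flip).hasFDerivAt.const_add l, fun u v w => rfl⟩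
  refine (l.hasFDerivAt.add (b.hasFDerivAt.clm_apply (hasFDerivAt_id u))).congr_fderiv ?_
  ext v; simp

/-- Second derivatives of a functional on a Hilbert space in terms of its gradient. -/
theorem hasFDerivAt_gradient {H : Type*} [NormedAddCommGroup H] [InnerProductSpace ℝ H]
    [CompleteSpace H] {J : H → ℝ} {D : H → H →L[ℝ] ℝ} {D₂ : H → H →L[ℝ] H →L[ℝ] ℝ}
    (hD : ∀ u, HasFDerivAt J (D u) u) (hD₂ : ∀ u, HasFDerivAt D (D₂ u) u) :
    Differentiable ℝ J ∧ Differentiable ℝ (gradient J) ∧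
      ∀ u v w, inner ℝ (fderiv ℝ (gradient J) u v) w = D₂ u v w := by
  -- The inverse Riesz map, a priori conjugate-linear, recast as a real-linear map so that the chain
  -- rule applies.
  let r : (H →L[ℝ] ℝ) →L[ℝ] H :=
    { toFun := fun f => (InnerProductSpace.toDual ℝ H).symm f
      map_add' := map_add _
      map_smul' := fun c f => by simp
      cont := (InnerProductSpace.toDual ℝ H).symm.continuous }
  have hr : gradient J = fun u => r (D u) := by
    ext1 u
    rw [gradient, (hD u).fderiv]; rfl
  have hg : ∀ u, HasFDerivAt (gradient J) (r ∘L D₂ u) u := fun u => by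
    rw [hr]; exact r.hasFDerivAt.comp u (hD₂ u)
  refine ⟨fun u => (hD u).differentiableAt, fun u => (hg u).differentiableAt, fun u v w => ?_⟩
  rw [(hg u).fderiv]
  exact InnerProductSpace.toDual_symm_apply

end TwiceDifferentiable

/-! ### Quadratic forms on the control space. -/

section QuadraticForms

variable {n m : ℕ} {t T : ℝ}

theorem Control.intervalIntegrable_inner_left {p : ℝ → Vec m} (htT : t ≤ T)
    (hp : ContinuousOn p (Icc t T)) (v : Control m t T) :
    IntervalIntegrable (fun s => inner ℝ (p s) (v s)) volume t T :=
  v.intervalIntegrable_clm_apply (C := fun s => innerSL ℝ (p s))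
    ((innerSL ℝ).continuous.comp_continuousOn hp) le_rfl htT le_rfl

theorem Control.intervalIntegrable_norm_mul_norm (htT : t ≤ T) (u v : Control m t T) :
    IntervalIntegrable (fun s => ‖u s‖ * ‖v s‖) volume t T := by
  rw [intervalIntegrable_iff_integrableOn_Ioc_of_le htT]
  exact (u.memLp_norm le_rfl le_rfl).integrable_mul (v.memLp_norm le_rfl le_rfl)

theorem Control.intervalIntegrable_inner_clm {R : ℝ → (Vec m →L[ℝ] Vec m)} (htT : t ≤ T)
    (hR : ContinuousOn R (Icc t T)) (u v : Control m t T) :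
    IntervalIntegrable (fun s => inner ℝ (R s (u s)) (v s)) volume t T := by
  obtain ⟨M, hM⟩ := isCompact_Icc.exists_bound_of_continuousOn hR
  have h := u.integrableOn_clm_apply hR
  rw [intervalIntegrable_iff_integrableOn_Ioc_of_le htT]
  refine Integrable.mono' (((intervalIntegrable_iff_integrableOn_Ioc_of_le htT).1
    (u.intervalIntegrable_norm_mul_norm htT v)).const_mul M)
    ((h.mono_set Ioc_subset_Icc_self).aestronglyMeasurable.inner
      (v.integrableOn.mono_set Ioc_subset_Icc_self).aestronglyMeasurable) ?_
  refine (ae_restrict_iff' measurableSet_Ioc).2 (ae_of_all _ fun s hs => ?_)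
  refine (norm_inner_le_norm _ _).trans ?_
  rw [← mul_assoc]
  exact mul_le_mul_of_nonneg_right ((ContinuousLinearMap.le_opNorm _ _).trans
    (mul_le_mul_of_nonneg_right (hM s (Ioc_subset_Icc_self hs)) (norm_nonneg _))) (norm_nonneg _)

/-- The bounded bilinear form `(u, v) ↦ ∫ ⟨K(s) u, v(s)⟩ + ½ ⟨R(s) u(s), v(s)⟩ ds` on `L²`. -/
theorem Control.exists_bilinear (htT : t ≤ T) {K : ℝ → Control m t T →L[ℝ] Vec m}
    {R : ℝ → (Vec m →L[ℝ] Vec m)} (hK : ContinuousOn K (Icc t T))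
    (hR : ContinuousOn R (Icc t T)) :
    ∃ b : Control m t T →L[ℝ] Control m t T →L[ℝ] ℝ, ∀ u v, b u v =
      ∫ s in t..T, (inner ℝ (K s u) (v s) + 1 / 2 * inner ℝ (R s (u s)) (v s)) := by
  obtain ⟨k, hk⟩ := isCompact_Icc.exists_bound_of_continuousOn hK
  obtain ⟨M, hM⟩ := isCompact_Icc.exists_bound_of_continuousOn hR
  have hk0 : 0 ≤ k := (norm_nonneg _).trans (hk t (left_mem_Icc.2 htT))
  have hM0 : 0 ≤ M := (norm_nonneg _).trans (hM t (left_mem_Icc.2 htT))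
  have hi : ∀ u v : Control m t T, IntervalIntegrable
      (fun s => inner ℝ (K s u) (v s) + 1 / 2 * inner ℝ (R s (u s)) (v s)) volume t T :=
    fun u v => (v.intervalIntegrable_inner_left htT (hK.clm_apply continuousOn_const)).add
      ((u.intervalIntegrable_inner_clm htT hR v).const_mul _)
  let b := LinearMap.mk₂ ℝ (fun u v : Control m t T =>
      ∫ s in t..T, (inner ℝ (K s u) (v s) + 1 / 2 * inner ℝ (R s (u s)) (v s)))
    (fun u u' v => by
      rw [← intervalIntegral.integral_add (hi u v) (hi u' v)]
      simp only [intervalIntegral.integral_of_le htT]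
      refine integral_congr_ae ?_
      filter_upwards [Control.ae_add u u'] with s hs
      rw [hs, map_add, map_add, inner_add_left, inner_add_left]
      ring)
    (fun c u v => by
      rw [← intervalIntegral.integral_smul]
      simp only [intervalIntegral.integral_of_le htT]
      refine integral_congr_ae ?_
      filter_upwards [Control.ae_smul c u] with s hs
      rw [hs, map_smul, map_smul, real_inner_smul_left, real_inner_smul_left, smul_eq_mul]
      ring)
    (fun u v v' => by
      rw [← intervalIntegral.integral_add (hi u v) (hi u v')]
      simp only [intervalIntegral.integral_of_le htT]
      refine integral_congr_ae ?_
      filter_upwards [Control.ae_add v v'] with s hs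
      rw [hs, inner_add_right, inner_add_right]
      ring)
    (fun c u v => by
      rw [← intervalIntegral.integral_smul]
      simp only [intervalIntegral.integral_of_le htT]
      refine integral_congr_ae ?_
      filter_upwards [Control.ae_smul c v] with s hs
      rw [hs, real_inner_smul_right, real_inner_smul_right, smul_eq_mul]
      ring)
  -- The two constants come from `∫ ‖v‖ ≤ √(T - t) ‖v‖_{L²}` and from Cauchy–Schwarz.
  refine ⟨b.mkContinuous₂ (k * √(T - t) + 1 / 2 * M) fun u v => ?_, fun u v => rfl⟩
  have hvn : IntervalIntegrable (fun s => ‖v s‖) volume t T :=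
    (intervalIntegrable_iff_integrableOn_Ioc_of_le htT).2
      (v.integrableOn.mono_set Ioc_subset_Icc_self).norm
  have h1 : IntervalIntegrable (fun s => k * ‖u‖ * ‖v s‖) volume t T := hvn.const_mul _
  have h2 : IntervalIntegrable (fun s => 1 / 2 * M * (‖u s‖ * ‖v s‖)) volume t T :=
    (u.intervalIntegrable_norm_mul_norm htT v).const_mul _
  calc ‖b u v‖ ≤ ∫ s in t..T, (k * ‖u‖ * ‖v s‖ + 1 / 2 * M * (‖u s‖ * ‖v s‖)) := by
        refine intervalIntegral.norm_integral_le_of_norm_le htT (ae_of_all _ fun s hs => ?_)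
          (h1.add h2)
        have hs' := Ioc_subset_Icc_self hs
        refine (norm_add_le _ _).trans (add_le_add ?_ ?_)
        · refine (norm_inner_le_norm _ _).trans ?_
          gcongr
          exact (K s).le_of_opNorm_le (hk s hs') u
        · rw [norm_mul, mul_assoc, ← mul_assoc M]
          norm_num
          refine (norm_inner_le_norm (𝕜 := ℝ) _ _).trans ?_
          gcongr
          exact (R s).le_of_opNorm_le (hM s hs') _
    _ = k * ‖u‖ * (∫ s in t..T, ‖v s‖) + 1 / 2 * M * ∫ s in t..T, ‖u s‖ * ‖v s‖ := by
        rw [intervalIntegral.integral_add h1 h2, intervalIntegral.integral_const_mul,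
          intervalIntegral.integral_const_mul]
    _ ≤ k * ‖u‖ * (√(T - t) * ‖v‖) + 1 / 2 * M * (‖u‖ * ‖v‖) := by
        gcongr
        · exact v.integral_norm_le le_rfl htT le_rfl
        · exact Control.integral_norm_mul_norm_le htT u v
    _ = _ := by ring

/-- Hilbert–Schmidt bound for `⟨M y, y⟩` with `y = ∫ C(r) v(r) dr`. -/
theorem Control.inner_integral_le {C : ℝ → (Vec m →L[ℝ] Vec n)} (hC : Continuous C)
    (M : Vec n →L[ℝ] Vec n) (v : Control m t T) {τ : ℝ} (hτ : τ ∈ Icc t T) :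
    inner ℝ (M (∫ r in t..τ, C r (v r))) (∫ r in t..τ, C r (v r))
      ≤ √(∫ r in t..τ, ∫ r' in t..τ, ‖(C r).adjoint ∘L M ∘L C r'‖ ^ 2)
        * ∫ r in t..τ, ‖v r‖ ^ 2 := by
  have hadj : Continuous fun r => (C r).adjoint :=
    (ContinuousLinearMap.adjoint (𝕜 := ℝ) (E := Vec m) (F := Vec n)).continuous.comp hC
  set y := ∫ r in t..τ, C r (v r) with hy
  set w := ∫ r in t..τ, ‖v r‖ ^ 2 with hw
  have hw0 : 0 ≤ w := intervalIntegral.integral_nonneg hτ.1 fun _ _ => by positivity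
  set k : ℝ → ℝ := fun r => ∫ r' in t..τ, ‖(C r).adjoint ∘L M ∘L C r'‖ ^ 2 with hkdef
  have hK : Continuous fun p : ℝ × ℝ => (C p.1).adjoint ∘L M ∘L C p.2 :=
    (hadj.comp continuous_fst).clm_comp (continuous_const.clm_comp (hC.comp continuous_snd))
  have hk : Continuous k :=
    intervalIntegral.continuous_parametric_intervalIntegral_of_continuous' (hK.norm.pow 2) t τ
  have hk0 : ∀ r, 0 ≤ k r := fun r =>
    intervalIntegral.integral_nonneg hτ.1 fun _ _ => by positivity
  have hv2 : MemLp (fun s => ‖v s‖) 2 (volume.restrict (Ioc t τ)) := v.memLp_norm le_rfl hτ.2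
  have hCv := v.intervalIntegrable_clm_apply hC.continuousOn le_rfl hτ.1 hτ.2
  have hmem : ∀ {f : ℝ → ℝ}, Continuous f → MemLp f 2 (volume.restrict (Ioc t τ)) := by
    intro f hf
    obtain ⟨b, hb⟩ := (isCompact_Icc (a := t) (b := τ)).exists_bound_of_continuousOn hf.continuousOn
    exact MemLp.of_bound hf.aestronglyMeasurable b ((ae_restrict_iff' measurableSet_Ioc).2
      (ae_of_all _ fun r hr => hb r (Ioc_subset_Icc_self hr)))
  -- Cauchy–Schwarz in `r'` bounds each row of the kernel by its `L²` norm `√(k r)`; a second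
  -- application, in `r`, gives `h5`. No sign of `M` is needed.
  have hinner : ∀ r, ‖(C r).adjoint (M y)‖ ≤ √(k r) * √w := by
    intro r
    have h1 : (C r).adjoint (M y) = ∫ r' in t..τ, ((C r).adjoint ∘L M ∘L C r') (v r') :=
      (ContinuousLinearMap.intervalIntegral_comp_comm ((C r).adjoint ∘L M) hCv).symm
    have h2 : Continuous fun r' => ‖(C r).adjoint ∘L M ∘L C r'‖ :=
      (hK.comp (continuous_const.prodMk continuous_id)).norm
    have h3 := integral_mul_le_sqrt_mul_sqrt (μ := volume.restrict (Ioc t τ))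
      (fun r' => norm_nonneg ((C r).adjoint ∘L M ∘L C r')) (fun r' => norm_nonneg (v r'))
      (hmem h2) hv2
    simp only [← intervalIntegral.integral_of_le hτ.1] at h3
    rw [h1]
    refine le_trans ?_ h3
    refine intervalIntegral.norm_integral_le_of_norm_le hτ.1
      (ae_of_all _ fun r' _ => ContinuousLinearMap.le_opNorm _ _) ?_
    exact (intervalIntegrable_iff_integrableOn_Ioc_of_le hτ.1).2 ((hmem h2).integrable_mul hv2)
  have h4 : inner ℝ (M y) y = ∫ r in t..τ, inner ℝ ((C r).adjoint (M y)) (v r) := by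
    have := ContinuousLinearMap.intervalIntegral_comp_comm (innerSL ℝ (M y)) hCv
    simp only [innerSL_apply_apply] at this
    rw [← this]
    exact intervalIntegral.integral_congr fun r _ =>
      (ContinuousLinearMap.adjoint_inner_left _ _ _).symm
  have hsk : Continuous fun r => √(k r) := hk.sqrt
  have h5 := integral_mul_le_sqrt_mul_sqrt (μ := volume.restrict (Ioc t τ))
    (fun r => Real.sqrt_nonneg (k r)) (fun r => norm_nonneg (v r)) (hmem hsk) hv2
  simp only [← intervalIntegral.integral_of_le hτ.1, Real.sq_sqrt (hk0 _)] at h5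
  have h6 : inner ℝ (M y) y ≤ ∫ r in t..τ, √w * (√(k r) * ‖v r‖) := by
    rw [h4]
    refine (Real.le_norm_self _).trans (intervalIntegral.norm_integral_le_of_norm_le hτ.1
      (ae_of_all _ fun r _ => ?_) ?_)
    · refine (norm_inner_le_norm _ _).trans ?_
      rw [← mul_assoc, mul_comm √w]
      exact mul_le_mul_of_nonneg_right (hinner r) (norm_nonneg _)
    · exact (intervalIntegrable_iff_integrableOn_Ioc_of_le hτ.1).2
        (((hmem hsk).integrable_mul hv2).const_mul _)
  rw [intervalIntegral.integral_const_mul] at h6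
  calc inner ℝ (M y) y ≤ √w * (√(∫ r in t..τ, k r) * √w) :=
        h6.trans (mul_le_mul_of_nonneg_left h5 (Real.sqrt_nonneg _))
    _ = √(∫ r in t..τ, k r) * (√w * √w) := by ring
    _ = _ := by rw [Real.mul_self_sqrt hw0]

/-- The Hilbert–Schmidt bound with kernel `Ψ(τ) Ξ(r) B(r) = Φ_A(τ, r) B(r)`, extended continuously
to all `r`. -/
theorem IsFlowPair.inner_le_kernelNorm {A : ℝ → (Vec n →L[ℝ] Vec n)}
    {Ψ Ξ : ℝ → (Vec n →L[ℝ] Vec n)} (hF : IsFlowPair A t T Ψ Ξ) {B : ℝ → (Vec m →L[ℝ] Vec n)}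
    (hB : ContinuousOn B (Icc t T)) (M : Vec n →L[ℝ] Vec n) (v : Control m t T) {τ : ℝ}
    (hτ : τ ∈ Icc t T) :
    inner ℝ (M (Ψ τ (∫ r in t..τ, Ξ r (B r (v r))))) (Ψ τ (∫ r in t..τ, Ξ r (B r (v r))))
      ≤ kernelNorm A B t T M τ * ∫ r in t..τ, ‖v r‖ ^ 2 := by
  have htT : t ≤ T := hτ.1.trans hτ.2
  have hC : ContinuousOn (fun r => Ψ τ ∘L Ξ r ∘L B r) (Icc t T) :=
    continuousOn_const.clm_comp (hF.continuousOn_right.clm_comp hB)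
  let C := fun r => Ψ τ ∘L Ξ r ∘L B r
  let C' := IccExtend htT ((Icc t T).domRestrict C)
  have hC' : Continuous C' := (continuousOn_iff_continuous_domRestrict.1 hC).Icc_extend'
  have hCC' : ∀ r ∈ uIcc t τ, C' r = C r := fun r hr => by
    rw [uIcc_of_le hτ.1] at hr
    exact IccExtend_of_mem htT _ ⟨hr.1, hr.2.trans hτ.2⟩
  have h1 : Ψ τ (∫ r in t..τ, Ξ r (B r (v r))) = ∫ r in t..τ, C' r (v r) := by
    refine (ContinuousLinearMap.intervalIntegral_comp_comm (Ψ τ)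
      (v.intervalIntegrable_clm_apply (hF.continuousOn_right.clm_comp hB) le_rfl hτ.1
        hτ.2)).symm.trans ?_
    exact intervalIntegral.integral_congr fun r hr => by simp only [hCC' r hr]; rfl
  have h2 : kernelNorm A B t T M τ
      = √(∫ r in t..τ, ∫ r' in t..τ, ‖(C' r).adjoint ∘L M ∘L C' r'‖ ^ 2) := by
    rw [kernelNorm]
    congr 1
    refine intervalIntegral.integral_congr fun r hr =>
      intervalIntegral.integral_congr fun r' hr' => ?_
    simp only [hCC' r hr, hCC' r' hr', C]
    rw [uIcc_of_le hτ.1] at hr hr'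
    rw [hF.fundamentalMatrix_eq hr.1 hr.2 hτ.2, hF.fundamentalMatrix_eq hr'.1 hr'.2 hτ.2]
    simp only [ContinuousLinearMap.adjoint_comp, ContinuousLinearMap.comp_assoc]
  rw [h1, h2]
  exact Control.inner_integral_le hC' M v hτ

/-- Completing the square in the control. -/
theorem two_mul_inner_add_inner_nonneg {R : Vec m →L[ℝ] Vec m} (hR : IsSelfAdjoint R) {ρ α : ℝ}
    (hρ : 0 < ρ) (hRρ : ∀ w, ρ * ‖w‖ ^ 2 ≤ inner ℝ (R w) w) (hα : 0 < α) (p v : Vec m) :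
    0 ≤ 2 * inner ℝ p v + α * inner ℝ (R v) v + α⁻¹ * inner ℝ (R.inverse p) p := by
  -- Coercivity makes `R` invertible, so `R.inverse` is the true inverse and not the default value
  -- `0`.
  have hinj : Function.Injective R := by
    rw [injective_iff_map_eq_zero]
    intro w hw
    have := hRρ w
    rw [hw, inner_zero_left] at this
    have h : ‖w‖ ^ 2 ≤ 0 := by nlinarith [sq_nonneg ‖w‖]
    simpa using le_antisymm h (by positivity)
  let e : Vec m ≃L[ℝ] Vec m :=
    (LinearEquiv.ofInjectiveEndo (R : Vec m →ₗ[ℝ] Vec m) hinj).toContinuousLinearEquiv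
  have he : R = (e : Vec m →L[ℝ] Vec m) := by ext1 w; rfl
  obtain ⟨z, rfl⟩ := e.surjective p
  have hz : R.inverse (e z) = z := by
    rw [he, ContinuousLinearMap.inverse_equiv]; exact e.symm_apply_apply z
  have hez : e z = R z := rfl
  have hsym : inner ℝ (R z) v = inner ℝ (R v) z := by
    rw [real_inner_comm, ← ContinuousLinearMap.adjoint_inner_left, hR.adjoint_eq]
  -- With `p = R z` the claimed expression is `α ⟨R (v + α⁻¹ z), v + α⁻¹ z⟩`.
  have h := hRρ (v + α⁻¹ • z)
  have h0 : 0 ≤ inner ℝ (R (v + α⁻¹ • z)) (v + α⁻¹ • z) := le_trans (by positivity) h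
  simp only [map_add, map_smul, inner_add_left, inner_add_right, real_inner_smul_left,
    real_inner_smul_right] at h0
  rw [hz, hez, real_inner_comm (R z) z]
  have h1 := mul_nonneg hα.le h0
  rw [hsym] at h1 ⊢
  field_simp at h1 ⊢
  linarith

end QuadraticForms

/-- Fubini moves the weight from the past of `v` to the future of `k`; this is why `Q̂(s, t)`
integrates over `[s, T]`. -/
theorem integral_mul_primitive {a b : ℝ} (hab : a ≤ b) {k g : ℝ → ℝ}
    (hk : IntervalIntegrable k volume a b) (hg : IntervalIntegrable g volume a b) :
    ∫ s in a..b, k s * ∫ r in a..s, g r = ∫ r in a..b, g r * ∫ s in r..b, k s := by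
  have h := integral_integral_triangle hab (f := fun r s => g r * k s)
    (((intervalIntegrable_iff_integrableOn_Ioc_of_le hab).1 hg).mul_prod
      ((intervalIntegrable_iff_integrableOn_Ioc_of_le hab).1 hk))
  simp only [intervalIntegral.integral_const_mul, intervalIntegral.integral_mul_const] at h
  rw [h]
  simp only [mul_comm]

/-! ### Coercivity of the second variation. -/

namespace AQProblem

variable {n m : ℕ} {t T : ℝ}

/-- The lower bound for the second variation in the direction `v`, in terms of the linear response
`y` of the state to `v`. -/
theorem le_second_variation (htT : t ≤ T) {A : ℝ → (Vec n →L[ℝ] Vec n)}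
    {B : ℝ → (Vec m →L[ℝ] Vec n)} {S : ℝ → (Vec n →L[ℝ] Vec m)} {R : ℝ → (Vec m →L[ℝ] Vec m)}
    (hSc : ContinuousOn S (Icc t T)) (hRc : ContinuousOn R (Icc t T))
    (hRs : ∀ s ∈ Icc t T, IsSelfAdjoint (R s)) {ρ : ℝ} (hρ : 0 < ρ)
    (hRρ : ∀ s ∈ Icc t T, ∀ w, ρ * ‖w‖ ^ 2 ≤ inner ℝ (R s w) w)
    {α δ : ℝ} (hα0 : 0 < α) {Qbar : ℝ → (Vec n →L[ℝ] Vec n)} {Gbar : Vec n →L[ℝ] Vec n}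
    (hint : IntervalIntegrable (fun τ => kernelNorm A B t T (Qbar τ) τ) volume t T)
    (hlarge : ∀ s ∈ Icc t T, ∀ w : Vec m,
      δ * ‖w‖ ^ 2 ≤ (1 - α) * inner ℝ (R s w) w
        - (GHat A B t T Gbar + QHat A B t T Qbar s) * ‖w‖ ^ 2)
    (v : Control m t T) {y : ℝ → Vec n} (hy : ContinuousOn y (Icc t T))
    (hyk : ∀ (M : Vec n →L[ℝ] Vec n), ∀ τ ∈ Icc t T,
      inner ℝ (M (y τ)) (y τ) ≤ kernelNorm A B t T M τ * ∫ r in t..τ, ‖v r‖ ^ 2)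
    {f : ℝ → ℝ} (hf : ContinuousOn f (Icc t T)) {c : ℝ}
    (hfy : ∀ s ∈ Icc t T, 0 ≤ f s + inner ℝ (Qbar s (y s)) (y s)
      - α⁻¹ * inner ℝ ((S s).adjoint ((R s).inverse (S s (y s)))) (y s))
    (hc : 0 ≤ c + inner ℝ (Gbar (y T)) (y T)) :
    δ * ‖v‖ ^ 2 ≤ (∫ s in t..T, f s)
      + 2 * (∫ s in t..T, (inner ℝ (S s (y s)) (v s) + 1 / 2 * inner ℝ (R s (v s)) (v s)))
      + c := by
  set k : ℝ → ℝ := fun τ => kernelNorm A B t T (Qbar τ) τ with hk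
  have hiv : IntervalIntegrable (fun s => ‖v s‖ ^ 2) volume t T :=
    (intervalIntegrable_iff_integrableOn_Ioc_of_le htT).2
      (v.integrableOn_norm_sq.mono_set Ioc_subset_Icc_self)
  have hiR := v.intervalIntegrable_inner_clm htT hRc v
  have hiS := v.intervalIntegrable_inner_left htT (hSc.clm_apply hy)
  have hif : IntervalIntegrable f volume t T :=
    ContinuousOn.intervalIntegrable (by rwa [uIcc_of_le htT])
  have hw : ContinuousOn (fun s => ∫ r in t..s, ‖v r‖ ^ 2) (uIcc t T) :=
    intervalIntegral.continuousOn_primitive_interval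
      (by rw [uIcc_of_le htT]; exact v.integrableOn_norm_sq)
  have hikw : IntervalIntegrable (fun s => k s * ∫ r in t..s, ‖v r‖ ^ 2) volume t T :=
    hint.mul_continuousOn hw
  have hQc : ContinuousOn (QHat A B t T Qbar) (uIcc t T) := by
    refine intervalIntegral.continuousOn_primitive_interval_left ?_
    rw [uIcc_of_le htT, integrableOn_Icc_iff_integrableOn_Ioc]
    exact (intervalIntegrable_iff_integrableOn_Ioc_of_le htT).1 hint
  have hiQ : IntervalIntegrable (fun s => ‖v s‖ ^ 2 * QHat A B t T Qbar s) volume t T :=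
    hiv.mul_continuousOn hQc
  have hswap : ∫ s in t..T, k s * ∫ r in t..s, ‖v r‖ ^ 2
      = ∫ s in t..T, ‖v s‖ ^ 2 * QHat A B t T Qbar s := integral_mul_primitive htT hint hiv
  have hcG : -(GHat A B t T Gbar * ‖v‖ ^ 2) ≤ c := by
    have := hyk Gbar T (right_mem_Icc.2 htT)
    rw [← Control.norm_sq_eq htT] at this
    simp only [GHat]
    linarith
  -- Pointwise: semiconvexity, the kernel bound for `Q̄(s)`, and the completed square, which uses up
  -- the share `α R`.
  have hrun : ∫ s in t..T, ((1 - α) * inner ℝ (R s (v s)) (v s)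
        - k s * ∫ r in t..s, ‖v r‖ ^ 2)
      ≤ ∫ s in t..T, (f s + 2 * (inner ℝ (S s (y s)) (v s)
        + 1 / 2 * inner ℝ (R s (v s)) (v s))) := by
    refine intervalIntegral.integral_mono_on htT ((hiR.const_mul _).sub hikw)
      (hif.add ((hiS.add (hiR.const_mul _)).const_mul _)) fun s hs => ?_
    have h1 := hfy s hs
    have h2 := hyk (Qbar s) s hs
    have h3 := two_mul_inner_add_inner_nonneg (hRs s hs) hρ (hRρ s hs) hα0 (S s (y s)) (v s)
    rw [ContinuousLinearMap.adjoint_inner_left] at h1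
    simp only [hk]
    linarith
  rw [intervalIntegral.integral_add hif ((hiS.add (hiR.const_mul _)).const_mul _),
    intervalIntegral.integral_const_mul, intervalIntegral.integral_sub (hiR.const_mul _) hikw,
    hswap] at hrun
  -- The largeness assumption at `w = v(s)`, integrated in `s`.
  have hlow : ∫ s in t..T, δ * ‖v s‖ ^ 2 ≤ ∫ s in t..T, ((1 - α) * inner ℝ (R s (v s)) (v s)
      - (GHat A B t T Gbar * ‖v s‖ ^ 2 + ‖v s‖ ^ 2 * QHat A B t T Qbar s)) := by
    refine intervalIntegral.integral_mono_on htT (hiv.const_mul _)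
      ((hiR.const_mul _).sub ((hiv.const_mul _).add hiQ)) fun s hs => ?_
    have := hlarge s hs (v s)
    linarith
  rw [intervalIntegral.integral_sub (hiR.const_mul _) ((hiv.const_mul _).add hiQ),
    intervalIntegral.integral_add (hiv.const_mul _) hiQ, intervalIntegral.integral_const_mul,
    intervalIntegral.integral_const_mul (GHat A B t T Gbar), ← Control.norm_sq_eq htT] at hlow
  linarith

end AQProblem

/-! ### The degenerate horizon and the main theorem. -/

theorem Control.eq_zero_of_self {m : ℕ} {t : ℝ} (u : Control m t t) : u = 0 := by
  have := Control.norm_sq_eq le_rfl u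
  simpa using this

end

theorem proposition5p4 {n m : ℕ} (P : AQProblem n m) (T t : ℝ) (ht : 0 ≤ t) (htT : t ≤ T)
    (h1 : P.H1 T) (h2 : P.H2 T) (h3 : P.H3 T)
    -- the linear structure of the coefficients
    (A : ℝ → (Vec n →L[ℝ] Vec n)) (B : ℝ → (Vec m →L[ℝ] Vec n))
    (S : ℝ → (Vec n →L[ℝ] Vec m)) (R : ℝ → (Vec m →L[ℝ] Vec m))
    (hA : ∀ s ∈ Set.Icc 0 T, ∀ x : Vec n, P.A s x = A s x)
    (hB : ∀ s ∈ Set.Icc 0 T, ∀ x : Vec n, P.B s x = B s)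
    (hS : ∀ s ∈ Set.Icc 0 T, ∀ x : Vec n, P.S s x = S s x)
    (hR : ∀ s ∈ Set.Icc 0 T, ∀ x : Vec n, P.R s x = R s)
    (α δ : ℝ) (hα0 : 0 < α) (hα1 : α < 1) (hδ : 0 < δ)
    (Qbar : ℝ → (Vec n →L[ℝ] Vec n)) (Gbar : Vec n →L[ℝ] Vec n)
    (hQbar : ∀ s ∈ Set.Icc 0 T, (Qbar s).IsPositive) (hGbar : Gbar.IsPositive)
    -- semi-convexity
    (hQxx : ∀ s ∈ Set.Icc t T, ∀ x h : Vec n,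
      0 ≤ hessianForm (P.Q s) x h + inner ℝ (Qbar s h) h
        - α⁻¹ * inner ℝ ((S s).adjoint ((R s).inverse (S s h))) h)
    (hGxx : ∀ x h : Vec n, 0 ≤ hessianForm P.G x h + inner ℝ (Gbar h) h)
    -- the integral defining `Q̂` exists
    (hint : IntervalIntegrable (fun τ => kernelNorm A B t T (Qbar τ) τ) MeasureTheory.volume t T)
    -- `R` is large enough
    (hlarge : ∀ s ∈ Set.Icc t T, ∀ w : Vec m,
      δ * ‖w‖ ^ 2 ≤ (1 - α) * inner ℝ (R s w) w
        - (GHat A B t T Gbar + QHat A B t T Qbar s) * ‖w‖ ^ 2) :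
    ∀ x : Vec n,
      -- the state equation is well-posed, so that `J(t, x; ·)` is defined
      (∀ u : Control m t T, ∃ X, P.IsTrajectory t T x u X ∧
        ∀ X', P.IsTrajectory t T x u X' → Set.EqOn X' X (Set.Icc t T)) ∧
      -- `J(t, x; ·)` is twice Fréchet differentiable on `L²(t, T; ℝᵐ)`
      Differentiable ℝ (P.cost t T x) ∧ Differentiable ℝ (P.DuJ t T x) ∧
      -- `D_uu J(t, x; u) ≥ δ I`, uniformly in `u`
      ∀ u v : Control m t T, δ * ‖v‖ ^ 2 ≤ inner ℝ (P.DuuJ t T x u v) v := by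
  intro x
  have hsub : Icc t T ⊆ Icc 0 T := Icc_subset_Icc_left ht
  have hslice : ∀ x : Vec n, ContinuousOn (fun s : ℝ => (s, x)) (Icc t T) := fun x =>
    continuousOn_id.prodMk continuousOn_const
  have hslice' : ∀ x : Vec n, MapsTo (fun s : ℝ => (s, x)) (Icc t T) (Icc 0 T ×ˢ univ) :=
    fun x s hs => ⟨hsub hs, mem_univ _⟩
  -- Only `s ↦ A(s) y` is known to be continuous for each `y`; in finite dimension this gives norm
  -- continuity.
  have hAc : ContinuousOn A (Icc t T) := continuousOn_clm_apply.2 fun y =>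
    (h1.1.comp (hslice y) (hslice' y)).congr fun s hs => (hA s (hsub hs) y).symm
  have hSc : ContinuousOn S (Icc t T) := continuousOn_clm_apply.2 fun y =>
    (h2.2.1.comp (hslice y) (hslice' y)).congr fun s hs => (hS s (hsub hs) y).symm
  have hBc : ContinuousOn B (Icc t T) :=
    (h1.2.1.comp (hslice 0) (hslice' 0)).congr fun s hs => (hB s (hsub hs) 0).symm
  have hRc : ContinuousOn R (Icc t T) :=
    (h2.2.2.1.comp (hslice 0) (hslice' 0)).congr fun s hs => (hR s (hsub hs) 0).symm
  have hA' : ∀ s ∈ Icc t T, ∀ x, P.A s x = A s x := fun s hs => hA s (hsub hs)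
  have hB' : ∀ s ∈ Icc t T, ∀ x, P.B s x = B s := fun s hs => hB s (hsub hs)
  obtain ⟨Ψ, Ξ, hF⟩ := exists_isFlowPair htT hAc
  have htraj := AQProblem.isTrajectory_of_isFlowPair htT hF hAc hBc hA' hB' x
  refine ⟨fun u => ⟨_, htraj u, fun X' hX' => (htraj u).eqOn htT hF hAc hA' hB' hX'⟩, ?_⟩
  -- For `t = T` the control space is trivial. Otherwise `0 < T`, as needed to differentiate `Q`
  -- jointly on `[0, T] × ℝⁿ`.
  rcases htT.eq_or_lt with rfl | hlt
  · have : Subsingleton (Control m t t) :=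
      ⟨fun u v => by rw [u.eq_zero_of_self, v.eq_zero_of_self]⟩
    refine ⟨fun u => (hasFDerivAt_of_subsingleton _ _).differentiableAt,
      fun u => (hasFDerivAt_of_subsingleton _ _).differentiableAt, fun u v => ?_⟩
    rw [v.eq_zero_of_self]
    simp
  obtain ⟨N, hNc, hN⟩ := Control.exists_primitive (C := fun r => Ξ r ∘L B r)
    (hF.continuousOn_right.clm_comp hBc)
  set X₀ : ℝ → Vec n := fun s => Ψ s x
  set Y : ℝ → Control m t T →L[ℝ] Vec n := fun s => Ψ s ∘L N s with hYdef
  have hX₀ : ContinuousOn X₀ (Icc t T) := hF.continuousOn_left.clm_apply continuousOn_const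
  have hY : ContinuousOn Y (Icc t T) := hF.continuousOn_left.clm_comp hNc
  have hX : ∀ u, EqOn (P.trajectory t T x u) (fun s => X₀ s + Y s u) (Icc t T) := by
    intro u s hs
    rw [AQProblem.trajectory_eqOn htT hF hAc hA' hB' (htraj u) hs]
    simp only [X₀, Y, ContinuousLinearMap.comp_apply, hN s hs, map_add]
  obtain ⟨-, -, hQ3, -, -, hG3⟩ := h3
  obtain ⟨hd1, hq1⟩ := ContDiffOn.fderiv_slice (k := 1) (f := P.Q) (ht.trans_lt hlt)
    (by exact_mod_cast hQ3)
  obtain ⟨hd2, hq2⟩ := ContDiffOn.fderiv_slice (k := 0) (f := fun s => fderiv ℝ (P.Q s))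
    (ht.trans_lt hlt) (by exact_mod_cast hq1)
  have hprod : Icc t T ×ˢ (univ : Set (Vec n)) ⊆ Icc 0 T ×ˢ univ := prod_mono hsub subset_rfl
  have hQc := h2.1.mono hprod
  have hq2c := hq2.continuousOn.mono hprod
  obtain ⟨D, D₂, hD, hD₂, hD₂v⟩ := exists_hasFDerivAt_fderiv_integral htT hQc
    (hq1.continuousOn.mono hprod) hq2c (fun s hs => hd1 s (hsub hs)) (fun s hs => hd2 s (hsub hs))
    hX₀ hY
  obtain ⟨DG, DG₂, hDG, hDG₂, hDG₂v⟩ := exists_hasFDerivAt_fderiv_comp_affine hG3 (X₀ T) (Y T)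
  obtain ⟨l, -, hl⟩ := Control.exists_primitive (t := t) (T := T)
    (C := fun s => innerSL ℝ (S s (X₀ s)))
    ((innerSL ℝ).continuous.comp_continuousOn (hSc.clm_apply hX₀))
  obtain ⟨b, hb⟩ := Control.exists_bilinear htT (K := fun s => S s ∘L Y s) (hSc.clm_comp hY) hRc
  obtain ⟨DB, DB₂, hDB, hDB₂, hDB₂v⟩ := exists_hasFDerivAt_fderiv_quadratic (l T) b
  have hTmem : T ∈ Icc t T := right_mem_Icc.2 htT
  have hXc : ∀ u, ContinuousOn (fun s => (s, X₀ s + Y s u)) (Icc t T) := fun u =>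
    continuousOn_id.prodMk (hX₀.add (hY.clm_apply continuousOn_const))
  have hXm : ∀ u, MapsTo (fun s => (s, X₀ s + Y s u)) (Icc t T) (Icc t T ×ˢ univ) :=
    fun u s hs => ⟨hs, mem_univ _⟩
  -- Splitting `S X = S X₀ + S Y u`: the first summand gives the linear functional `l T`, the second
  -- joins `½ R` in `b`.
  have hcost : P.cost t T x = fun u => ((∫ s in t..T, P.Q s (X₀ s + Y s u)) + (l T u + b u u))
      + P.G (X₀ T + Y T u) := by
    ext1 u
    have hi1 : IntervalIntegrable (fun s => P.Q s (X₀ s + Y s u)) volume t T := by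
      refine ContinuousOn.intervalIntegrable ?_
      rw [uIcc_of_le htT]
      exact hQc.comp (hXc u) (hXm u)
    have hi2 := u.intervalIntegrable_inner_left htT (hSc.clm_apply hX₀)
    have hi3 := u.intervalIntegrable_inner_left htT
      (hSc.clm_apply (hY.clm_apply (continuousOn_const (c := u))))
    have hi4 := (u.intervalIntegrable_inner_clm htT hRc u).const_mul (1 / 2)
    have hlu : l T u = ∫ s in t..T, inner ℝ (S s (X₀ s)) (u s) := hl T hTmem u
    have hbu : b u u = ∫ s in t..T, (inner ℝ (S s (Y s u)) (u s)
      + 1 / 2 * inner ℝ (R s (u s)) (u s)) := hb u u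
    rw [AQProblem.cost, hX u hTmem, hlu, hbu, ← intervalIntegral.integral_add hi2 (hi3.add hi4),
      ← intervalIntegral.integral_add hi1 (hi2.add (hi3.add hi4))]
    congr 1
    refine intervalIntegral.integral_congr fun s hs => ?_
    rw [uIcc_of_le htT] at hs
    simp only [hX u hs, hS s (hsub hs), hR s (hsub hs), map_add, inner_add_left]
    ring
  obtain ⟨hJ1, hJ2, hJ3⟩ := hasFDerivAt_gradient (J := P.cost t T x)
    (D := fun u => (D u + DB u) + DG u) (D₂ := fun u => (D₂ u + DB₂ u) + DG₂ u)
    (fun u => by rw [hcost]; exact ((hD u).add (hDB u)).add (hDG u))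
    (fun u => ((hD₂ u).add (hDB₂ u)).add (hDG₂ u))
  refine ⟨hJ1, hJ2, fun u v => ?_⟩
  obtain ⟨-, -, -, -, hRs, _, _, _, _, _, ρ₀, ρ, -, -, -, -, -, -, hρ₀, -, hρ, hbd⟩ := h2
  have hRs' : ∀ s ∈ Icc t T, IsSelfAdjoint (R s) := fun s hs => by
    rw [← hR s (hsub hs) 0]; exact hRs s (hsub hs) 0
  have hRρ : ∀ s ∈ Icc t T, ∀ w, ρ₀ * ‖w‖ ^ 2 ≤ inner ℝ (R s w) w := fun s hs w => by
    rw [← hR s (hsub hs) 0]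
    exact (mul_le_mul_of_nonneg_right (hρ 0) (by positivity)).trans ((hbd s (hsub hs) 0).1 w)
  have hyk : ∀ (M : Vec n →L[ℝ] Vec n), ∀ τ ∈ Icc t T, inner ℝ (M (Y τ v)) (Y τ v)
      ≤ kernelNorm A B t T M τ * ∫ r in t..τ, ‖v r‖ ^ 2 := fun M τ hτ => by
    simp only [Y, ContinuousLinearMap.comp_apply, hN τ hτ]
    exact hF.inner_le_kernelNorm hBc M v hτ
  have hYv : ContinuousOn (fun s => Y s v) (Icc t T) := hY.clm_apply continuousOn_const
  have hfinal := AQProblem.le_second_variation htT hSc hRc hRs' hρ₀ hRρ hα0 hint hlarge v hYv hyk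
    (f := fun s => fderiv ℝ (fderiv ℝ (P.Q s)) (X₀ s + Y s u) (Y s v) (Y s v))
    (((hq2c.comp (hXc u) (hXm u)).clm_apply hYv).clm_apply hYv)
    (fun s hs => hQxx s hs (X₀ s + Y s u) (Y s v)) (hGxx (X₀ T + Y T u) (Y T v))
  refine hfinal.trans_eq ?_
  have hval : inner ℝ (P.DuuJ t T x u v) v = D₂ u v v + DB₂ u v v + DG₂ u v v := hJ3 u v v
  have hbv : b v v = ∫ s in t..T, (inner ℝ (S s (Y s v)) (v s)
      + 1 / 2 * inner ℝ (R s (v s)) (v s)) := hb v v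
  rw [hval, hD₂v, hDB₂v, hDG₂v, ← hbv, two_mul]
  rfl
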